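/- Let $\mathbb{K}=\mathbb{R}$ or $\mathbb{C}$, let $A\in\mathbb{K}^{n\times n}$ be self-adjoint and let $A=X\Lambda X^*$ be an eigendecomposition of $A$: $X$ is unitary with columns $x_1,\dots,x_n$, and $\Lambda=\mathrm{diag}(\lambda_1,\dots,\lambda_n)$ with $\lambda_1\ge\dots\ge\lambda_n$. For $0\le\ell\le n$ put $\mathcal X_\ell=\mathrm{span}\{x_1,\dots,x_\ell\}$, $\Lambda_\ell=\mathrm{diag}(\lambda_1,\dots,\lambda_\ell)$ and $\Lambda_{\ell,\perp}=\mathrm{diag}(\lambda_{\ell+1},\dots,\lambda_n)$ (an empty matrix has norm $0$). Let $0\le j<h<k\le\mathrm{rk}(A)$ be such that $\lambda_j>\lambda_{j+1}$ (no condition if $j=0$) and $\lambda_k>\lambda_{k+1}$ (no condition if $k=n$), and let $$\Lambda\text{-adm}_h(A)=\{\mathcal S\subset\mathbb{K}^n:\ \dim\mathcal S=h,\ \mathcal X_j\subset\mathcal S\subset\mathcal X_k\}.$$ For subspaces $\mathcal S,\mathcal T\subset\mathbb{K}^n$ and $m=\min\{\dim\mathcal S,\dim\mathcal T\}$, let $\Theta(\mathcal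 S,\mathcal T)=\mathrm{diag}(\theta_1,\dots,\theta_m)$ be the diagonal matrix of principal angles $0\le\theta_1\le\dots\le\theta_m\le\pi/2$ between $\mathcal S$ and $\mathcal T$; $\cos\theta_i$ is the $i$-th largest singular value of $S^*T$, where the columns of $S$ and $T$ are orthonormal bases of $\mathcal S$ and $\mathcal T$. A unitarily invariant norm $\|\cdot\|$ on $\mathbb{K}^{n\times n}$ is a norm with $\|UMV\|=\|M\|$ for all $M$ and all unitary (orthogonal, if $\mathbb K=\mathbb R$) $U,V$; it is evaluated at $\sin\Theta$ and $\tan\Theta$ after completing these diagonal matrices by zeros to size $n\times n$. For such a norm put $$d(\Lambda\text{-adm}_h(A),\mathcal T)=\inf\{\|\sin\Theta(\mathcal S,\mathcal T)\|:\ \mathcal S\in\Lambda\text{-adm}_h(A)\},$$ and let $\|\cdot\|_2$ denote the spectral norm. **Theorem.** Let $\mathcal W\subset\mathbb{K}^n$ be a subspace with $\dim\mathcal W=r$ and $h\le r<k$. Let $p_1,p_2\ge 0$ be integers with $p_1+p_2\le r-h$ and $k+p_2\le n$, and assume that $$\mathcal W^\perp\cap\mathrm{span}\{x_1,\dots,x_{j+p_1},x_{k+1},\dots,x_{k+p_2}\}=\{0\}\quad\text{and}\quad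 \mathcal W\cap\mathrm{span}\{x_1,\dots,x_k\}^\perp=\{0\}.$$ Then there exists a subspace $\mathcal H_p\subset\mathcal W$ with $\dim\mathcal H_p=r-(p_1+p_2)\ge h$, $\mathcal H_p^\perp\cap\mathcal X_j=\{0\}$ and $\mathcal H_p\cap\mathcal X_k^\perp=\{0\}$ such that, for every polynomial $\phi\in\mathbb{K}[x]$ with $\phi(\Lambda_k)$ invertible and every unitarily invariant norm $\|\cdot\|$, $$d(\Lambda\text{-adm}_h(A),\phi(A)(\mathcal W))\le \|\phi(\Lambda_j)^{-1}\|_2\,\|\phi(\Lambda_{j+p_1,\perp})\|_2\,\|\tan\Theta(\mathcal X_j,\mathcal H_p)\| + \|\phi(\Lambda_k)^{-1}\|_2\,\|\phi(\Lambda_{k+p_2,\perp})\|_2\,\|\tan\Theta(\mathcal X_k,\mathcal H_p)\|.$$ If $j=0$, the first term on the right-hand side may be omitted; if $k=\mathrm{rk}(A)$ and $\phi(0)=0$, the second term may be omitted; if both hold, both may be omitted. -/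

import Mathlib

open Module

noncomputable section

namespace LambdaAdm

variable {𝕜 : Type*} [RCLike 𝕜] {n : ℕ}

/-- `A = X Λ X*` with `X` unitary and `Λ = diag(lam)`, where the real numbers `lam` are arranged
in non-increasing order. Such an `A` is self-adjoint, and `lam` is the list of its
eigenvalues, with multiplicities. Indices start at `0`: the one-based `λ_i`, `x_i` are
`lam (i - 1)` and the column `i - 1` of `X`. -/
structure IsEigendecomposition (A X : Matrix (Fin n) (Fin n) 𝕜) (lam : Fin n → ℝ) : Prop where
  antitone : Antitone lam
  unitary : X ∈ Matrix.unitaryGroup (Fin n) 𝕜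
  eq : A = X * Matrix.diagonal (fun i => (lam i : 𝕜)) * X.conjTranspose

/-- A matrix with an eigendecomposition (with real eigenvalues) is self-adjoint. -/
theorem IsEigendecomposition.isHermitian {A X : Matrix (Fin n) (Fin n) 𝕜} {lam : Fin n → ℝ}
    (hA : IsEigendecomposition A X lam) : A.IsHermitian := by
  have hd : (Matrix.diagonal (fun i => (lam i : 𝕜))).IsHermitian := by
    apply Matrix.isHermitian_diagonal_of_self_adjoint
    ext i
    simp
  rw [hA.eq]
  exact Matrix.isHermitian_mul_mul_conjTranspose X hd

/-- The gap condition `λ_ℓ > λ_{ℓ+1}` (one-based). It is void for `ℓ = 0` (as `λ_0 = ∞`)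
and for `ℓ = n`, where `λ_{n+1}` does not exist. -/
def HasGap (lam : Fin n → ℝ) (l : ℕ) : Prop :=
  ∀ i i' : Fin n, (i : ℕ) + 1 = l → (i' : ℕ) = l → lam i' < lam i

/-- The columns of `X`, as vectors of the Euclidean space. -/
def column (X : Matrix (Fin n) (Fin n) 𝕜) (i : Fin n) : EuclideanSpace 𝕜 (Fin n) :=
  WithLp.toLp 2 (fun a => X a i)

/-- The span of the first `l` columns of `X`. -/
def leadingSpan (X : Matrix (Fin n) (Fin n) 𝕜) (l : ℕ) :
    Submodule 𝕜 (EuclideanSpace 𝕜 (Fin n)) :=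
  Submodule.span 𝕜 (column X '' {i | (i : ℕ) < l})

/-- The diagonal matrix `Λ_l` of the `l` largest eigenvalues. -/
def leadingDiag (𝕜 : Type*) [RCLike 𝕜] (lam : Fin n → ℝ) (l : ℕ) :
    Matrix {i : Fin n // (i : ℕ) < l} {i : Fin n // (i : ℕ) < l} 𝕜 :=
  Matrix.diagonal (fun i => (lam i.1 : 𝕜))

/-- The diagonal matrix `Λ_{l,⊥}` of the remaining `n - l` eigenvalues. -/
def trailingDiag (𝕜 : Type*) [RCLike 𝕜] (lam : Fin n → ℝ) (l : ℕ) :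
    Matrix {i : Fin n // l ≤ (i : ℕ)} {i : Fin n // l ≤ (i : ℕ)} 𝕜 :=
  Matrix.diagonal (fun i => (lam i.1 : 𝕜))

/-- The spectral norm `‖M‖₂`: the operator norm of `M` for Euclidean norms. -/
def specNorm {m : Type*} [Fintype m] [DecidableEq m] (M : Matrix m m 𝕜) : ℝ :=
  ‖Matrix.toEuclideanCLM (n := m) (𝕜 := 𝕜) M‖

/-- The image `M(W)` of a subspace under a matrix. -/
def image (M : Matrix (Fin n) (Fin n) 𝕜) (W : Submodule 𝕜 (EuclideanSpace 𝕜 (Fin n))) :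
    Submodule 𝕜 (EuclideanSpace 𝕜 (Fin n)) :=
  W.map (Matrix.toEuclideanLin M)

/-- A unitarily invariant norm on `n × n` matrices. -/
structure IsUnitarilyInvariantNorm (N : Seminorm 𝕜 (Matrix (Fin n) (Fin n) 𝕜)) : Prop where
  definite : ∀ M, N M = 0 → M = 0
  invariant : ∀ U ∈ Matrix.unitaryGroup (Fin n) 𝕜, ∀ V ∈ Matrix.unitaryGroup (Fin n) 𝕜,
    ∀ M, N (U * M * V) = N M

/-- The principal angles `θ_i(S,T)`, `i < min (dim S) (dim T)`, in non-decreasing order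
(zero-based): `cos θ_i(S,T)` is the `i`-th largest singular value of `S* T`, for matrices `S`,
`T` with orthonormal columns spanning the two subspaces. For `i < min (dim S) (dim T)` these
singular values are the same as those of `S S* T T* = P_S P_T`, which is used here. -/
def principalAngle (S T : Submodule 𝕜 (EuclideanSpace 𝕜 (Fin n))) (i : ℕ) : ℝ :=
  Real.arccos (((S.starProjection ∘L T.starProjection :
    EuclideanSpace 𝕜 (Fin n) →L[𝕜] EuclideanSpace 𝕜 (Fin n)) :
    EuclideanSpace 𝕜 (Fin n) →ₗ[𝕜] EuclideanSpace 𝕜 (Fin n)).singularValues i)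

/-- The diagonal matrix `f(Θ(S,T))` with diagonal entries `f(θ_i(S,T))`,
`i < min (dim S) (dim T)`, completed by zeros to an `n × n` matrix so that unitarily invariant
norms apply to it. -/
def angleMatrix (f : ℝ → ℝ) (S T : Submodule 𝕜 (EuclideanSpace 𝕜 (Fin n))) :
    Matrix (Fin n) (Fin n) 𝕜 :=
  Matrix.diagonal (fun i =>
    if (i : ℕ) < min (finrank 𝕜 S) (finrank 𝕜 T) then ((f (principalAngle S T i) : ℝ) : 𝕜) else 0)

/-- The class `Λ-adm_h(A)` of `h`-dimensional `Λ`-admissible subspaces, for the enveloping indices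
`j < h < k` and the eigenvector matrix `X`. -/
def admissible (X : Matrix (Fin n) (Fin n) 𝕜) (j h k : ℕ) :
    Set (Submodule 𝕜 (EuclideanSpace 𝕜 (Fin n))) :=
  {S | finrank 𝕜 S = h ∧ leadingSpan X j ≤ S ∧ S ≤ leadingSpan X k}

/-- `d(Λ-adm_h(A), T) = inf {‖sin Θ(S,T)‖ : S ∈ Λ-adm_h(A)}`. -/
def admDist (N : Seminorm 𝕜 (Matrix (Fin n) (Fin n) 𝕜)) (X : Matrix (Fin n) (Fin n) 𝕜)
    (j h k : ℕ) (T : Submodule 𝕜 (EuclideanSpace 𝕜 (Fin n))) : ℝ :=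
  sInf ((fun S => N (angleMatrix Real.sin S T)) '' admissible X j h k)

/-- `‖φ(Λ_l)⁻¹‖₂ ‖φ(Λ_{l+p,⊥})‖₂ ‖tan Θ(X_l, H)‖`. -/
def boundTerm (N : Seminorm 𝕜 (Matrix (Fin n) (Fin n) 𝕜)) (X : Matrix (Fin n) (Fin n) 𝕜)
    (lam : Fin n → ℝ) (φ : Polynomial 𝕜) (l p : ℕ)
    (H : Submodule 𝕜 (EuclideanSpace 𝕜 (Fin n))) : ℝ :=
  specNorm (Polynomial.aeval (leadingDiag 𝕜 lam l) φ)⁻¹ *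
    specNorm (Polynomial.aeval (trailingDiag 𝕜 lam (l + p)) φ) *
    N (angleMatrix Real.tan (leadingSpan X l) H)

end LambdaAdm

end

/-! Let `Q` be the span of the eigenvectors `x_i` in the blocks `j < i ≤ j + p₁` and `k < i ≤ k +
p₂`. The required subspace is `H = W ∩ Q^⊥`: it has dimension `r - (p₁ + p₂)` because the sum `W^⊥ +
Q` is direct, and its vectors have no components in the two blocks.

Write `T = φ(A)(W)` and let `U = X_l` with `l = j` or `l = k`. Principal vectors exhibit inside `H`
a graph `{v + K v : v ∈ V}` with `V ≤ U`, where `K` maps into `U^⊥` and has the tangents as singular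
values (`exists_tangent_map`). As `φ(A)(v + K v) ∈ T`, the vector `y = φ(A) v` agrees modulo `T`
with `-φ(A) K v = -C K B y`; here `B` inverts `φ(A)` on `U`, and `C` is `φ(A)` cut down to the
indices beyond `l + p`. So `‖P_{T^⊥} y‖ ≤ ‖C K B y‖`, and the norm of `C K B` is at most the bound
term (`exists_graph_bound`).

For `l = j` such `y` fill `X_j`; for `l = k` they fill a subspace of `X_k` of dimension `dim H ≥ h`.
Completing `X_j` by vectors of the latter orthogonal to `X_j` gives an admissible `S` whose
projection is a sum of two projections. Since `‖sin Θ(S,T)‖` is the norm of `P_{T^⊥} P_S`, the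
triangle inequality yields the two terms (`exists_between_norm_sin_le`). The norm estimates all rest
on contractions being convex combinations of isometries (`seminorm_le_of_contraction`). -/

noncomputable section

namespace LambdaAdm

/-! ### Singular value decomposition and contractions -/

section OrthonormalBasis

variable {𝕜 E : Type*} [RCLike 𝕜] [NormedAddCommGroup E] [InnerProductSpace 𝕜 E]
  [FiniteDimensional 𝕜 E]

/-- A pairwise orthogonal family of the right cardinality consists of nonnegative multiples of the
vectors of an orthonormal basis. -/
theorem exists_orthonormalBasis_eq_norm_smul {ι : Type*} [Fintype ι]
    (hcard : finrank 𝕜 E = Fintype.card ι) (v : ι → E)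
    (hv : Pairwise fun i j => inner 𝕜 (v i) (v j) = 0) :
    ∃ c : OrthonormalBasis ι 𝕜 E, ∀ i, v i = (‖v i‖ : 𝕜) • c i := by
  classical
  have horth : Orthonormal 𝕜
      (({i | v i ≠ 0} : Set ι).domRestrict fun i => ((‖v i‖ : ℝ) : 𝕜)⁻¹ • v i) := by
    constructor
    · rintro ⟨i, hi⟩
      have : ‖v i‖ ≠ 0 := norm_ne_zero_iff.mpr hi
      simp [Set.domRestrict, norm_smul, this]
    · rintro ⟨i, hi⟩ ⟨i', hi'⟩ hne
      have : i ≠ i' := fun h => hne (Subtype.ext h)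
      simp [Set.domRestrict, inner_smul_left, inner_smul_right, hv this]
  obtain ⟨c, hc⟩ := horth.exists_orthonormalBasis_extension_of_card_eq hcard
  refine ⟨c, fun i => ?_⟩
  by_cases hi : v i = 0
  · simp [hi]
  · have : ((‖v i‖ : ℝ) : 𝕜) ≠ 0 := by simpa using hi
    rw [hc i hi, smul_inv_smul₀ this]

/-- Singular value decomposition of an endomorphism. -/
theorem exists_svd {n : ℕ} (hn : finrank 𝕜 E = n) (f : E →ₗ[𝕜] E) :
    ∃ b c : OrthonormalBasis (Fin n) 𝕜 E, ∀ i, f (b i) = (f.singularValues i : 𝕜) • c i := by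
  set b := f.isSymmetric_adjoint_comp_self.eigenvectorBasis hn with hb
  -- An eigenbasis of `f* f` is sent by `f` to orthogonal vectors whose norms are the singular
  -- values.
  have key : ∀ i i', inner 𝕜 (f (b i)) (f (b i')) =
      ((f.singularValues i' ^ 2 : ℝ) : 𝕜) * inner 𝕜 (b i) (b i') := by
    intro i i'
    rw [← LinearMap.adjoint_inner_right, f.sq_singularValues_fin hn, ← inner_smul_right]
    congr 1
    exact f.isSymmetric_adjoint_comp_self.apply_eigenvectorBasis hn i'
  have hnorm : ∀ i, ‖f (b i)‖ = f.singularValues i := by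
    intro i
    have h := key i i
    rw [inner_self_eq_norm_sq_to_K, inner_self_eq_norm_sq_to_K, b.norm_eq_one] at h
    have h' : ‖f (b i)‖ ^ 2 = f.singularValues i ^ 2 := by
      have : ((‖f (b i)‖ ^ 2 : ℝ) : 𝕜) = ((f.singularValues i ^ 2 : ℝ) : 𝕜) := by
        rw [RCLike.ofReal_pow, h]; simp
      exact_mod_cast this
    exact (sq_eq_sq₀ (norm_nonneg _) (f.singularValues_nonneg i)).mp h'
  obtain ⟨c, hc⟩ := exists_orthonormalBasis_eq_norm_smul (𝕜 := 𝕜) (by simpa using hn)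
    (fun i => f (b i)) (fun i i' hne => by
      change inner 𝕜 (f (b i)) (f (b i')) = 0
      rw [key, b.inner_eq_zero hne, mul_zero])
  exact ⟨b, c, fun i => by rw [← hnorm]; exact hc i⟩

/-- The linear map taking `b i` to `s i • c i`. -/
def scaleMap {ι : Type*} [Fintype ι] (b c : OrthonormalBasis ι 𝕜 E) (s : ι → ℝ) : E →ₗ[𝕜] E :=
  b.toBasis.constr 𝕜 fun i => (s i : 𝕜) • c i

omit [FiniteDimensional 𝕜 E] in
theorem scaleMap_apply {ι : Type*} [Fintype ι] (b c : OrthonormalBasis ι 𝕜 E) (s : ι → ℝ) (i : ι) :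
    scaleMap b c s (b i) = (s i : 𝕜) • c i := by
  have := b.toBasis.constr_basis 𝕜 (fun i => (s i : 𝕜) • c i) i
  simpa [scaleMap] using this

/-- A seminorm that is at most `M` on isometries is at most `M` on contractions: contractions are
convex combinations of isometries. -/
theorem seminorm_le_of_contraction (p : Seminorm 𝕜 (E →ₗ[𝕜] E)) {M : ℝ}
    (hp : ∀ U : E ≃ₗᵢ[𝕜] E, p U.toLinearEquiv.toLinearMap ≤ M) (f : E →ₗ[𝕜] E)
    (hf : ∀ x, ‖f x‖ ≤ ‖x‖) : p f ≤ M := by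
  obtain ⟨b, c, hbc⟩ := exists_svd rfl f
  have hconv : Convex ℝ {s : Fin (finrank 𝕜 E) → ℝ | p (scaleMap b c s) ≤ M} := by
    intro s hs t ht a a' ha ha' haa
    have : scaleMap b c (a • s + a' • t) =
        (a : 𝕜) • scaleMap b c s + (a' : 𝕜) • scaleMap b c t := by
      refine b.toBasis.ext fun i => ?_
      simp [scaleMap_apply, add_smul, mul_smul]
    change p _ ≤ M
    rw [this]
    calc _ ≤ p ((a : 𝕜) • scaleMap b c s) + p ((a' : 𝕜) • scaleMap b c t) := map_add_le_add p _ _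
      _ = a * p (scaleMap b c s) + a' * p (scaleMap b c t) := by
        rw [map_smul_eq_mul, map_smul_eq_mul, RCLike.norm_ofReal, RCLike.norm_ofReal,
          abs_of_nonneg ha, abs_of_nonneg ha']
      _ ≤ a * M + a' * M := by gcongr <;> assumption
      _ = M := by rw [← add_mul, haa, one_mul]
  -- At a vertex of the cube `[-1, 1]^n` the map is an isometry. The singular values of a
  -- contraction form a point of that cube, hence of the convex hull of the vertices.
  have hsign : Set.univ.pi (fun _ => ({-1, 1} : Set ℝ)) ⊆
      {s : Fin (finrank 𝕜 E) → ℝ | p (scaleMap b c s) ≤ M} := by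
    intro s hs
    have hs' : ∀ i, |s i| = 1 := fun i => by
      rcases hs i trivial with h | h <;> simp_all
    obtain ⟨c', hc'⟩ := exists_orthonormalBasis_eq_norm_smul (𝕜 := 𝕜) (E := E) (by simp)
      (fun i => (s i : 𝕜) • c i) (fun i i' hne => by
        simp [inner_smul_left, inner_smul_right, c.inner_eq_zero hne])
    have : scaleMap b c s = (b.equiv c' (Equiv.refl _)).toLinearEquiv.toLinearMap := by
      refine b.toBasis.ext fun i => ?_
      have h1 := hc' i
      simp only [norm_smul, RCLike.norm_ofReal, hs', c.norm_eq_one, one_mul, RCLike.ofReal_one,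
        one_smul] at h1
      simp [scaleMap_apply, h1]
    change p _ ≤ M
    rw [this]
    exact hp _
  have hmem : (fun i : Fin (finrank 𝕜 E) => f.singularValues i) ∈
      convexHull ℝ (Set.univ.pi (fun _ => ({-1, 1} : Set ℝ))) := by
    refine mem_convexHull_pi fun i _ => ?_
    have h0 := f.singularValues_nonneg i
    have h1 : f.singularValues i ≤ 1 := by
      have := hf (b i)
      rwa [hbc, norm_smul, c.norm_eq_one, b.norm_eq_one, mul_one, RCLike.norm_ofReal,
        abs_of_nonneg h0] at this
    rw [convexHull_pair, segment_eq_Icc (by norm_num)]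
    exact ⟨by linarith, h1⟩
  have := convexHull_min hsign hconv hmem
  have heq : scaleMap b c (fun i : Fin (finrank 𝕜 E) => f.singularValues i) = f :=
    b.toBasis.ext fun i => by simp [scaleMap_apply, hbc]
  rwa [Set.mem_ofPred_eq, heq] at this

/-- A linear map that is pointwise bounded by `g` factors through `g` by a contraction. -/
theorem exists_contraction_comp_eq (f g : E →ₗ[𝕜] E) (hfg : ∀ x, ‖f x‖ ≤ ‖g x‖) :
    ∃ C : E →ₗ[𝕜] E, (∀ x, ‖C x‖ ≤ ‖x‖) ∧ C ∘ₗ g = f := by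
  obtain ⟨s, hs⟩ := g.rangeRestrict.exists_rightInverse_of_surjective g.range_rangeRestrict
  have hgs : ∀ y : g.range, g (s y) = y := fun y => by
    have := LinearMap.congr_fun hs y
    simpa using congrArg Subtype.val this
  refine ⟨f ∘ₗ s ∘ₗ (g.range.orthogonalProjectionOnto : E →ₗ[𝕜] g.range), fun x => ?_, ?_⟩
  · calc _ ≤ ‖g (s (g.range.orthogonalProjectionOnto x))‖ := hfg _
      _ = ‖g.range.orthogonalProjectionOnto x‖ := by rw [hgs]; rfl
      _ ≤ ‖x‖ := g.range.norm_orthogonalProjectionOnto_apply_le x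
  · ext x
    have h1 : g.range.orthogonalProjectionOnto (g x) = ⟨g x, LinearMap.mem_range_self g x⟩ :=
      Submodule.orthogonalProjectionOnto_mem_subspace_eq_self (K := g.range)
        ⟨g x, LinearMap.mem_range_self g x⟩
    -- Two preimages under `g` differ by an element of its kernel, on which `f` vanishes by
    -- domination; the choice of section is therefore harmless.
    have h2 := hfg (s ⟨g x, LinearMap.mem_range_self g x⟩ - x)
    rw [map_sub, map_sub, hgs, sub_self, norm_zero, norm_le_zero_iff, sub_eq_zero] at h2
    simpa [h1] using h2

end OrthonormalBasis

/-! ### Unitarily invariant norms of linear maps -/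

section UnitarilyInvariant

variable {𝕜 : Type*} [RCLike 𝕜] {n : ℕ}

/-- A seminorm on matrices, as a seminorm on endomorphisms of the Euclidean space. -/
def mapNorm (N : Seminorm 𝕜 (Matrix (Fin n) (Fin n) 𝕜)) :
    Seminorm 𝕜 (EuclideanSpace 𝕜 (Fin n) →ₗ[𝕜] EuclideanSpace 𝕜 (Fin n)) :=
  N.comp Matrix.toEuclideanLin.symm.toLinearMap

variable {N : Seminorm 𝕜 (Matrix (Fin n) (Fin n) 𝕜)}

theorem toEuclideanLin_symm_mem_unitaryGroup
    (U : EuclideanSpace 𝕜 (Fin n) ≃ₗᵢ[𝕜] EuclideanSpace 𝕜 (Fin n)) :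
    Matrix.toEuclideanLin.symm U.toLinearEquiv.toLinearMap ∈ Matrix.unitaryGroup (Fin n) 𝕜 := by
  rw [Matrix.mem_unitaryGroup_iff', Matrix.star_eq_conjTranspose]
  apply Matrix.toEuclideanLin.injective
  rw [Matrix.toLpLin_mul_same, Matrix.toEuclideanLin_conjTranspose_eq_adjoint,
    LinearEquiv.apply_symm_apply, Matrix.toLpLin_one]
  ext1 x
  refine ext_inner_left 𝕜 fun y => ?_
  simp [LinearMap.adjoint_inner_right]

theorem IsUnitarilyInvariantNorm.mapNorm_comp_isometry (hN : IsUnitarilyInvariantNorm N)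
    (U V : EuclideanSpace 𝕜 (Fin n) ≃ₗᵢ[𝕜] EuclideanSpace 𝕜 (Fin n))
    (f : EuclideanSpace 𝕜 (Fin n) →ₗ[𝕜] EuclideanSpace 𝕜 (Fin n)) :
    mapNorm N (U.toLinearEquiv.toLinearMap ∘ₗ f ∘ₗ V.toLinearEquiv.toLinearMap) = mapNorm N f := by
  have := hN.invariant _ (toEuclideanLin_symm_mem_unitaryGroup U) _
    (toEuclideanLin_symm_mem_unitaryGroup V) (Matrix.toEuclideanLin.symm f)
  rw [← Matrix.toLpLin_symm_comp, ← Matrix.toLpLin_symm_comp] at this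
  exact this

/-- With `f` fixed, the left side is a seminorm in `C`, and it equals the right side at every
isometry. -/
theorem IsUnitarilyInvariantNorm.mapNorm_comp_left_le (hN : IsUnitarilyInvariantNorm N)
    (C f : EuclideanSpace 𝕜 (Fin n) →ₗ[𝕜] EuclideanSpace 𝕜 (Fin n))
    (hC : ∀ x, ‖C x‖ ≤ ‖x‖) : mapNorm N (C ∘ₗ f) ≤ mapNorm N f := by
  refine seminorm_le_of_contraction ((mapNorm N).comp (LinearMap.lcomp 𝕜 _ f)) (fun U => ?_) C hC
  exact (hN.mapNorm_comp_isometry U (LinearIsometryEquiv.refl 𝕜 _) f).le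

theorem IsUnitarilyInvariantNorm.mapNorm_comp_right_le (hN : IsUnitarilyInvariantNorm N)
    (C f : EuclideanSpace 𝕜 (Fin n) →ₗ[𝕜] EuclideanSpace 𝕜 (Fin n))
    (hC : ∀ x, ‖C x‖ ≤ ‖x‖) : mapNorm N (f ∘ₗ C) ≤ mapNorm N f := by
  refine seminorm_le_of_contraction ((mapNorm N).comp (LinearMap.compRight 𝕜 f))
    (fun U => ?_) C hC
  exact (hN.mapNorm_comp_isometry (LinearIsometryEquiv.refl 𝕜 _) U f).le

/-- A linear map bounded by `a` is `a` times a contraction. -/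
theorem exists_contraction_smul_eq
    (C : EuclideanSpace 𝕜 (Fin n) →ₗ[𝕜] EuclideanSpace 𝕜 (Fin n)) {a : ℝ} (ha : 0 ≤ a)
    (hC : ∀ x, ‖C x‖ ≤ a * ‖x‖) :
    ∃ C' : EuclideanSpace 𝕜 (Fin n) →ₗ[𝕜] EuclideanSpace 𝕜 (Fin n),
      (∀ x, ‖C' x‖ ≤ ‖x‖) ∧ C = (a : 𝕜) • C' := by
  rcases ha.eq_or_lt with rfl | ha
  · refine ⟨0, by simp, LinearMap.ext fun x => ?_⟩
    simpa using hC x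
  · have ha' : (a : 𝕜) ≠ 0 := by exact_mod_cast ha.ne'
    refine ⟨(a : 𝕜)⁻¹ • C, fun x => ?_, (smul_inv_smul₀ ha' C).symm⟩
    rw [LinearMap.smul_apply, norm_smul, norm_inv, RCLike.norm_ofReal, abs_of_pos ha,
      inv_mul_le_iff₀ ha]
    exact hC x

theorem IsUnitarilyInvariantNorm.mapNorm_comp_comp_le (hN : IsUnitarilyInvariantNorm N)
    (C f D : EuclideanSpace 𝕜 (Fin n) →ₗ[𝕜] EuclideanSpace 𝕜 (Fin n)) {a b : ℝ}
    (ha : 0 ≤ a) (hb : 0 ≤ b) (hC : ∀ x, ‖C x‖ ≤ a * ‖x‖) (hD : ∀ x, ‖D x‖ ≤ b * ‖x‖) :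
    mapNorm N (C ∘ₗ f ∘ₗ D) ≤ b * a * mapNorm N f := by
  obtain ⟨C', hC', rfl⟩ := exists_contraction_smul_eq C ha hC
  obtain ⟨D', hD', rfl⟩ := exists_contraction_smul_eq D hb hD
  rw [LinearMap.comp_smul, LinearMap.comp_smul, LinearMap.smul_comp, map_smul_eq_mul,
    map_smul_eq_mul, RCLike.norm_ofReal, RCLike.norm_ofReal, abs_of_nonneg ha, abs_of_nonneg hb,
    mul_assoc]
  gcongr
  exact (hN.mapNorm_comp_left_le C' _ hC').trans (hN.mapNorm_comp_right_le D' f hD')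

/-- Pointwise domination makes `f` a contraction composed with `g`. -/
theorem IsUnitarilyInvariantNorm.mapNorm_mono (hN : IsUnitarilyInvariantNorm N)
    (f g : EuclideanSpace 𝕜 (Fin n) →ₗ[𝕜] EuclideanSpace 𝕜 (Fin n))
    (hfg : ∀ x, ‖f x‖ ≤ ‖g x‖) : mapNorm N f ≤ mapNorm N g := by
  obtain ⟨C, hC, rfl⟩ := exists_contraction_comp_eq f g hfg
  exact hN.mapNorm_comp_left_le C g hC

/-- The value of a unitarily invariant norm at a map with a given singular value decomposition. -/
theorem IsUnitarilyInvariantNorm.mapNorm_eq_diagonal (hN : IsUnitarilyInvariantNorm N)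
    (f : EuclideanSpace 𝕜 (Fin n) →ₗ[𝕜] EuclideanSpace 𝕜 (Fin n))
    (b : OrthonormalBasis (Fin n) 𝕜 (EuclideanSpace 𝕜 (Fin n))) (d : Fin n → ℝ)
    (hd : ∀ i, ‖f (b i)‖ = d i) (ho : Pairwise fun i i' => inner 𝕜 (f (b i)) (f (b i')) = 0) :
    mapNorm N f = N (Matrix.diagonal fun i => (d i : 𝕜)) := by
  obtain ⟨c, hc⟩ := exists_orthonormalBasis_eq_norm_smul (𝕜 := 𝕜)
    (E := EuclideanSpace 𝕜 (Fin n)) (by simp) (fun i => f (b i)) ho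
  rw [← hN.mapNorm_comp_isometry c.repr b.repr.symm f]
  change N _ = _
  congr 1
  rw [LinearEquiv.coe_toLinearMap, LinearEquiv.symm_apply_eq]
  refine (EuclideanSpace.basisFun (Fin n) 𝕜).toBasis.ext fun i => ?_
  have h1 := hc i
  simp only [hd] at h1
  have h2 : c.repr (f (b i)) = (d i : 𝕜) • EuclideanSpace.single i 1 := by
    rw [h1, map_smul, c.repr_self]
  have h3 : (c.repr.toLinearEquiv.toLinearMap ∘ₗ f ∘ₗ b.repr.symm.toLinearEquiv.toLinearMap)
      (EuclideanSpace.single i 1) = c.repr (f (b i)) := by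
    simp
  rw [OrthonormalBasis.coe_toBasis, EuclideanSpace.basisFun_apply, h3, h2]
  ext i'
  simp [Matrix.toLpLin_apply, RCLike.real_smul_eq_coe_mul]

end UnitarilyInvariant

/-! ### Principal angles, sines and tangents -/

section PrincipalVectors

variable {𝕜 : Type*} [RCLike 𝕜] {n : ℕ}

/-- The cosine of the `i`-th principal angle. -/
def principalCos (S T : Submodule 𝕜 (EuclideanSpace 𝕜 (Fin n))) (i : ℕ) : ℝ :=
  ((S.starProjection ∘L T.starProjection :
    EuclideanSpace 𝕜 (Fin n) →L[𝕜] EuclideanSpace 𝕜 (Fin n)) :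
    EuclideanSpace 𝕜 (Fin n) →ₗ[𝕜] EuclideanSpace 𝕜 (Fin n)).singularValues i

theorem principalAngle_eq (S T : Submodule 𝕜 (EuclideanSpace 𝕜 (Fin n))) (i : ℕ) :
    principalAngle S T i = Real.arccos (principalCos S T i) := rfl

theorem principalCos_nonneg (S T : Submodule 𝕜 (EuclideanSpace 𝕜 (Fin n))) (i : ℕ) :
    0 ≤ principalCos S T i := LinearMap.singularValues_nonneg _ i

/-- The nonzero singular values of `P_S P_T` are counted by its rank, and its range is the
projection of `T` to `S`. -/
theorem principalCos_ne_zero_iff (S T : Submodule 𝕜 (EuclideanSpace 𝕜 (Fin n))) (i : ℕ) :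
    principalCos S T i ≠ 0 ↔ i < finrank 𝕜 (T.map S.starProjection.toLinearMap) := by
  rw [principalCos, ← LinearMap.singularValues_pos_iff_ne_zero,
    LinearMap.singularValues_pos_iff_lt_finrank_range, ContinuousLinearMap.toLinearMap_comp,
    LinearMap.range_comp, Submodule.range_starProjection]

theorem principalCos_eq_zero_of_le (S T : Submodule 𝕜 (EuclideanSpace 𝕜 (Fin n))) {i : ℕ}
    (hi : finrank 𝕜 S ≤ i) : principalCos S T i = 0 := by
  by_contra h
  rw [← ne_eq, principalCos_ne_zero_iff] at h
  have : T.map S.starProjection.toLinearMap ≤ S := by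
    rintro _ ⟨x, -, rfl⟩
    exact S.starProjection_apply_mem x
  have := Submodule.finrank_mono this
  omega

/-- Left and right principal vectors of a pair of subspaces. -/
theorem exists_principal_vectors (S T : Submodule 𝕜 (EuclideanSpace 𝕜 (Fin n))) :
    ∃ b c : OrthonormalBasis (Fin n) 𝕜 (EuclideanSpace 𝕜 (Fin n)),
      (∀ i, S.starProjection (T.starProjection (b i)) = (principalCos S T i : 𝕜) • c i) ∧
      (∀ i, T.starProjection (S.starProjection (c i)) = (principalCos S T i : 𝕜) • b i) ∧
      ∀ i : Fin n, principalCos S T i ≠ 0 → b i ∈ T ∧ c i ∈ S := by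
  obtain ⟨b, c, hbc⟩ := exists_svd finrank_euclideanSpace_fin
    ((S.starProjection ∘L T.starProjection :
      EuclideanSpace 𝕜 (Fin n) →L[𝕜] EuclideanSpace 𝕜 (Fin n)) :
      EuclideanSpace 𝕜 (Fin n) →ₗ[𝕜] EuclideanSpace 𝕜 (Fin n))
  have h1 : ∀ i, S.starProjection (T.starProjection (b i)) = (principalCos S T i : 𝕜) • c i := hbc
  -- `P_T P_S` is the adjoint of `P_S P_T`, so it reverses the singular pairs.
  have h2 : ∀ i, T.starProjection (S.starProjection (c i)) = (principalCos S T i : 𝕜) • b i := by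
    intro i
    refine InnerProductSpace.ext_inner_left_basis b.toBasis fun i' => ?_
    rw [b.coe_toBasis, ← Submodule.inner_starProjection_left_eq_right,
      ← Submodule.inner_starProjection_left_eq_right, h1, inner_smul_left, inner_smul_right,
      RCLike.conj_ofReal, orthonormal_iff_ite.mp c.orthonormal,
      orthonormal_iff_ite.mp b.orthonormal]
    split_ifs with h
    · rw [h]
    · simp
  refine ⟨b, c, h1, h2, fun i hi => ⟨?_, ?_⟩⟩
  · have hi' : (principalCos S T i : 𝕜) ≠ 0 := by exact_mod_cast hi
    rw [← Submodule.smul_mem_iff _ hi', ← h2]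
    exact T.starProjection_apply_mem _
  · have hi' : (principalCos S T i : 𝕜) ≠ 0 := by exact_mod_cast hi
    rw [← Submodule.smul_mem_iff _ hi', ← h1]
    exact S.starProjection_apply_mem _

/-- Through this identity, orthogonality of vectors and of their projections to `T` passes to their
projections to `T^⊥`. -/
theorem inner_starProjection_orthogonal (T : Submodule 𝕜 (EuclideanSpace 𝕜 (Fin n)))
    (x y : EuclideanSpace 𝕜 (Fin n)) :
    inner 𝕜 (Tᗮ.starProjection x) (Tᗮ.starProjection y) =
      inner 𝕜 x y - inner 𝕜 (T.starProjection x) (T.starProjection y) := by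
  rw [Submodule.inner_starProjection_left_eq_right, Submodule.inner_starProjection_left_eq_right,
    Submodule.starProjection_eq_self_iff.mpr (Submodule.starProjection_apply_mem _ _),
    Submodule.starProjection_eq_self_iff.mpr (Submodule.starProjection_apply_mem _ _),
    Submodule.starProjection_orthogonal_val, inner_sub_right]

theorem norm_starProjection_orthogonal (T : Submodule 𝕜 (EuclideanSpace 𝕜 (Fin n)))
    {x : EuclideanSpace 𝕜 (Fin n)} (hx : ‖x‖ = 1) :
    ‖Tᗮ.starProjection x‖ = √(1 - ‖T.starProjection x‖ ^ 2) := by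
  rw [eq_comm, Real.sqrt_eq_iff_eq_sq _ (norm_nonneg _)]
  · have := Submodule.norm_sq_eq_add_norm_sq_starProjection x T
    rw [hx] at this
    linarith
  · have := Submodule.norm_sq_eq_add_norm_sq_starProjection x T
    rw [hx] at this
    nlinarith [sq_nonneg ‖Tᗮ.starProjection x‖]

/-- An orthonormal basis adapted to `S` that diagonalizes `P_S P_T P_S`. -/
theorem exists_adapted_orthonormalBasis (S T : Submodule 𝕜 (EuclideanSpace 𝕜 (Fin n))) :
    ∃ b e : OrthonormalBasis (Fin n) 𝕜 (EuclideanSpace 𝕜 (Fin n)),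
      (∀ i : Fin n, (i : ℕ) < finrank 𝕜 S → e i ∈ S ∧
        T.starProjection (e i) = (principalCos S T i : 𝕜) • b i) ∧
      ∀ i : Fin n, finrank 𝕜 S ≤ (i : ℕ) → e i ∈ Sᗮ := by
  classical
  obtain ⟨b, c, hb, hc, hmem⟩ := exists_principal_vectors S T
  have hle : finrank 𝕜 S ≤ n := by simpa using S.finrank_le
  -- A principal vector `c i` with zero cosine need not lie in `S`. Only those with nonzero cosine
  -- are kept, and they are extended to an orthonormal basis of `S`.
  obtain ⟨s, hs⟩ := exists_orthonormalBasis_eq_norm_smul (𝕜 := 𝕜) (E := S)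
    (ι := Fin (finrank 𝕜 S)) (by simp)
    (fun i => if hi : principalCos S T i ≠ 0
      then ⟨c (i.castLE hle), (hmem (i.castLE hle) hi).2⟩ else 0)
    (fun i i' hne => by
      have : i.castLE hle ≠ i'.castLE hle := fun h => hne (Fin.castLE_injective hle h)
      dsimp only
      split_ifs with h1 h2
      · simpa using c.inner_eq_zero this
      all_goals simp)
  have hsc : ∀ i : Fin (finrank 𝕜 S), principalCos S T i ≠ 0 → (s i : EuclideanSpace 𝕜 (Fin n)) = c (i.castLE hle) := by
    intro i hi
    have h1 := hs i
    simp only [dif_pos hi] at h1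
    have h2 := congrArg Subtype.val h1
    simpa using h2.symm
  obtain ⟨e, he⟩ := exists_orthonormalBasis_eq_norm_smul (𝕜 := 𝕜)
    (E := EuclideanSpace 𝕜 (Fin n)) (ι := Fin n) (by simp)
    (fun i => if hi : (i : ℕ) < finrank 𝕜 S then (s ⟨i, hi⟩ : EuclideanSpace 𝕜 (Fin n)) else 0)
    (fun i i' hne => by
      dsimp only
      split_ifs with h1 h2
      · have : (⟨i, h1⟩ : Fin (finrank 𝕜 S)) ≠ ⟨i', h2⟩ := fun h =>
          hne (Fin.ext (Fin.mk.inj h))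
        rw [← Submodule.coe_inner]
        exact s.inner_eq_zero this
      all_goals simp)
  have hes : ∀ (i : Fin n) (hi : (i : ℕ) < finrank 𝕜 S), e i = s ⟨i, hi⟩ := by
    intro i hi
    have h1 := he i
    have h2 : ‖(s ⟨i, hi⟩ : EuclideanSpace 𝕜 (Fin n))‖ = 1 := s.norm_eq_one _
    simp only [dif_pos hi] at h1
    rw [h2, RCLike.ofReal_one, one_smul] at h1
    exact h1.symm
  refine ⟨b, e, fun i hi => ?_, fun i hi => ?_⟩
  · have hei : e i ∈ S := by rw [hes i hi]; exact Subtype.property _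
    refine ⟨hei, ?_⟩
    have hPe : S.starProjection (e i) = e i := Submodule.starProjection_eq_self_iff.mpr hei
    -- For a replaced vector, the `b i'` coordinate of its projection to `T` is a multiple of `⟪c
    -- i', e i⟫` by the cosine at `i'`. If this cosine is nonzero, then `c i' = e i'` with `i' ≠ i`,
    -- so every coordinate vanishes.
    by_cases h0 : principalCos S T i = 0
    · rw [h0, RCLike.ofReal_zero, zero_smul]
      refine InnerProductSpace.ext_inner_left_basis b.toBasis fun i' => ?_
      rw [b.coe_toBasis, inner_zero_right, ← hPe, ← Submodule.inner_starProjection_left_eq_right,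
        ← Submodule.inner_starProjection_left_eq_right, hb, inner_smul_left]
      by_cases h1 : principalCos S T i' = 0
      · simp [h1]
      · have h2 : (i' : ℕ) < finrank 𝕜 S := by
          by_contra h
          exact h1 (principalCos_eq_zero_of_le S T (by omega))
        have h3 : c i' = e i' := by rw [hes i' h2, hsc ⟨i', h2⟩ h1]; rfl
        have h4 : i' ≠ i := by rintro rfl; exact h1 h0
        rw [h3, e.inner_eq_zero h4, mul_zero]
    · have : e i = c i := by rw [hes i hi, hsc ⟨i, hi⟩ h0]; rfl
      rw [← hc, ← this, hPe]
  · rw [Submodule.mem_orthogonal]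
    intro y hy
    have h1 := congrArg Subtype.val (s.sum_repr ⟨y, hy⟩)
    rw [Submodule.coe_sum] at h1
    simp only at h1
    rw [← h1, sum_inner]
    refine Finset.sum_eq_zero fun l _ => ?_
    have h2 : (s l : EuclideanSpace 𝕜 (Fin n)) = e (l.castLE hle) :=
      (hes (l.castLE hle) l.isLt).symm
    have h3 : l.castLE hle ≠ i := by
      rintro rfl
      have := l.isLt
      simp at hi
      omega
    rw [Submodule.coe_smul, inner_smul_left, h2, e.inner_eq_zero h3, mul_zero]

/-- The norm of `sin Θ(S,T)` is the norm of `P_{T^⊥} P_S`, if `dim S ≤ dim T`. -/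
theorem IsUnitarilyInvariantNorm.norm_sin_angleMatrix
    {N : Seminorm 𝕜 (Matrix (Fin n) (Fin n) 𝕜)} (hN : IsUnitarilyInvariantNorm N)
    (S T : Submodule 𝕜 (EuclideanSpace 𝕜 (Fin n))) (hST : finrank 𝕜 S ≤ finrank 𝕜 T) :
    N (angleMatrix Real.sin S T) =
      mapNorm N (Tᗮ.starProjection.toLinearMap ∘ₗ S.starProjection.toLinearMap) := by
  obtain ⟨b, e, he, he'⟩ := exists_adapted_orthonormalBasis S T
  have hlt : ∀ i : Fin n, (i : ℕ) < finrank 𝕜 S →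
      Tᗮ.starProjection (S.starProjection (e i)) = Tᗮ.starProjection (e i) := fun i hi => by
    rw [Submodule.starProjection_eq_self_iff.mpr (he i hi).1]
  have hge : ∀ i : Fin n, ¬ (i : ℕ) < finrank 𝕜 S →
      Tᗮ.starProjection (S.starProjection (e i)) = 0 := fun i hi => by
    rw [(Submodule.starProjection_apply_eq_zero_iff S).mpr (he' i (not_lt.mp hi)), map_zero]
  rw [hN.mapNorm_eq_diagonal _ e (fun i => if (i : ℕ) < finrank 𝕜 S then
    Real.sin (principalAngle S T i) else 0)]
  · rw [angleMatrix, min_eq_left hST]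
    congr 2
    ext i
    split_ifs <;> simp
  · intro i
    change ‖Tᗮ.starProjection (S.starProjection (e i))‖ = _
    split_ifs with hi
    · rw [hlt i hi, norm_starProjection_orthogonal T (e.norm_eq_one i), (he i hi).2, norm_smul,
        b.norm_eq_one, mul_one, RCLike.norm_ofReal, sq_abs, principalAngle_eq, Real.sin_arccos]
    · rw [hge i hi, norm_zero]
  · intro i i' hne
    change inner 𝕜 (Tᗮ.starProjection (S.starProjection (e i)))
      (Tᗮ.starProjection (S.starProjection (e i'))) = 0
    by_cases hi : (i : ℕ) < finrank 𝕜 S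
    · by_cases hi' : (i' : ℕ) < finrank 𝕜 S
      · rw [hlt i hi, hlt i' hi', inner_starProjection_orthogonal, e.inner_eq_zero hne, (he i hi).2,
          (he i' hi').2, inner_smul_left, inner_smul_right, b.inner_eq_zero hne]
        simp
      · rw [hge i' hi', inner_zero_right]
    · rw [hge i hi, inner_zero_left]

theorem finrank_map_starProjection_of_inf_eq_bot
    (U H : Submodule 𝕜 (EuclideanSpace 𝕜 (Fin n))) (h : H ⊓ Uᗮ = ⊥) :
    finrank 𝕜 (H.map U.starProjection.toLinearMap) = finrank 𝕜 H := by
  rw [← LinearMap.range_domRestrict]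
  refine LinearMap.finrank_range_of_inj ?_
  rw [← LinearMap.ker_eq_bot, LinearMap.ker_eq_bot']
  rintro ⟨x, hx⟩ h0
  have : x ∈ H ⊓ Uᗮ := ⟨hx, (Submodule.starProjection_apply_eq_zero_iff U).mp h0⟩
  rw [h, Submodule.mem_bot] at this
  exact Subtype.ext this

/-- The two dimensions are the ranks of `P_U P_H` and of its adjoint `P_H P_U`. -/
theorem finrank_map_starProjection_comm (U H : Submodule 𝕜 (EuclideanSpace 𝕜 (Fin n))) :
    finrank 𝕜 (H.map U.starProjection.toLinearMap) =
      finrank 𝕜 (U.map H.starProjection.toLinearMap) := by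
  have h1 : ∀ S T : Submodule 𝕜 (EuclideanSpace 𝕜 (Fin n)),
      T.map S.starProjection.toLinearMap =
        (S.starProjection.toLinearMap ∘ₗ T.starProjection.toLinearMap).range := fun S T => by
    rw [LinearMap.range_comp, Submodule.range_starProjection]
  have h2 : LinearMap.adjoint (U.starProjection.toLinearMap ∘ₗ H.starProjection.toLinearMap) =
      H.starProjection.toLinearMap ∘ₗ U.starProjection.toLinearMap := by
    rw [eq_comm, LinearMap.eq_adjoint_iff]
    intro x y
    simp [Submodule.inner_starProjection_left_eq_right]
  rw [h1, h1, ← h2, LinearMap.finrank_range_adjoint]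

/-- If all principal angles between `U` and `H` are acute, `H` contains the graph over a subspace
of `U` of a linear map with values in `U^⊥` whose singular values are the tangents. -/
theorem exists_tangent_map (U H : Submodule 𝕜 (EuclideanSpace 𝕜 (Fin n)))
    (hUH : H ⊓ Uᗮ = ⊥ ∨ Hᗮ ⊓ U = ⊥) :
    ∃ (V : Submodule 𝕜 (EuclideanSpace 𝕜 (Fin n)))
      (K : EuclideanSpace 𝕜 (Fin n) →ₗ[𝕜] EuclideanSpace 𝕜 (Fin n)),
      V ≤ U ∧ finrank 𝕜 V = min (finrank 𝕜 U) (finrank 𝕜 H) ∧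
      (∀ v ∈ V, v + K v ∈ H) ∧ (∀ v, K v ∈ Uᗮ) ∧
      ∀ N : Seminorm 𝕜 (Matrix (Fin n) (Fin n) 𝕜), IsUnitarilyInvariantNorm N →
        mapNorm N K = N (angleMatrix Real.tan U H) := by
  classical
  set m := min (finrank 𝕜 U) (finrank 𝕜 H) with hm
  have hpos : ∀ i < m, principalCos U H i ≠ 0 := by
    intro i hi
    rw [principalCos_ne_zero_iff]
    rcases hUH with h | h
    · rw [finrank_map_starProjection_of_inf_eq_bot U H h]
      omega
    · rw [finrank_map_starProjection_comm, finrank_map_starProjection_of_inf_eq_bot H U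
        (by rwa [inf_comm])]
      omega
  have hmn : m ≤ n := (min_le_left _ _).trans (by simpa using U.finrank_le)
  obtain ⟨b, c, hb, hc, hmem⟩ := exists_principal_vectors U H
  have hbU : ∀ i : Fin n, (i : ℕ) < m →
      U.starProjection (b i) = (principalCos U H i : 𝕜) • c i := fun i hi => by
    rw [← hb, Submodule.starProjection_eq_self_iff.mpr (hmem i (hpos i hi)).1]
  -- Since `b i = cos θ_i • c i + P_{U^⊥} (b i)` lies in `H`, division by the cosine makes `c i + K
  -- (c i)` a multiple of `b i`. The value zero at the other indices matches the padding of the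
  -- tangent matrix.
  let K : EuclideanSpace 𝕜 (Fin n) →ₗ[𝕜] EuclideanSpace 𝕜 (Fin n) :=
    c.toBasis.constr 𝕜 fun i => if (i : ℕ) < m
      then ((principalCos U H i)⁻¹ : 𝕜) • Uᗮ.starProjection (b i) else 0
  have hK : ∀ i, K (c i) = if (i : ℕ) < m
      then ((principalCos U H i)⁻¹ : 𝕜) • Uᗮ.starProjection (b i) else 0 := fun i => by
    have := c.toBasis.constr_basis 𝕜 (fun i : Fin n => if (i : ℕ) < m
      then ((principalCos U H i)⁻¹ : 𝕜) • Uᗮ.starProjection (b i) else 0) i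
    rwa [c.coe_toBasis] at this
  refine ⟨Submodule.span 𝕜 (Set.range fun i : Fin m => c (i.castLE hmn)), K, ?_, ?_, ?_, ?_, ?_⟩
  · rw [Submodule.span_le]
    rintro _ ⟨i, rfl⟩
    exact (hmem _ (hpos i i.isLt)).2
  · have := finrank_span_eq_card (R := 𝕜) (b := fun i : Fin m => c (i.castLE hmn))
      (c.orthonormal.linearIndependent.comp _ (Fin.castLE_injective hmn))
    rw [this, Fintype.card_fin]
  · intro v hv
    have hle : Submodule.span 𝕜 (Set.range fun i : Fin m => c (i.castLE hmn)) ≤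
        H.comap (LinearMap.id + K) := by
      rw [Submodule.span_le]
      rintro _ ⟨i, rfl⟩
      have hi : ((i.castLE hmn : Fin n) : ℕ) < m := i.isLt
      have hi' : (principalCos U H (i.castLE hmn : Fin n) : 𝕜) ≠ 0 := by
        exact_mod_cast hpos _ hi
      change c (i.castLE hmn) + K (c (i.castLE hmn)) ∈ H
      rw [hK, if_pos hi, Submodule.starProjection_orthogonal_val, hbU _ hi, smul_sub,
        inv_smul_smul₀ hi', add_sub_cancel]
      exact H.smul_mem _ (hmem _ (hpos _ hi)).1
    exact hle hv
  · intro v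
    have hle : ⊤ ≤ Uᗮ.comap K := by
      rw [← c.toBasis.span_eq, Submodule.span_le]
      rintro _ ⟨i, rfl⟩
      rw [c.coe_toBasis]
      change K (c i) ∈ Uᗮ
      rw [hK]
      split_ifs
      · exact Submodule.smul_mem _ _ (Submodule.starProjection_apply_mem _ _)
      · exact zero_mem _
    exact hle trivial
  · intro N hN
    rw [hN.mapNorm_eq_diagonal K c (fun i => if (i : ℕ) < m then
      Real.tan (principalAngle U H i) else 0)]
    · rw [angleMatrix]
      congr 2
      ext i
      split_ifs <;> simp
    · intro i
      rw [hK]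
      split_ifs with hi
      · rw [norm_smul, norm_starProjection_orthogonal U (b.norm_eq_one i), hbU i hi, norm_smul,
          c.norm_eq_one, norm_inv, RCLike.norm_ofReal, mul_one, sq_abs, principalAngle_eq,
          Real.tan_arccos, abs_of_nonneg (principalCos_nonneg _ _ _), inv_mul_eq_div]
      · exact norm_zero
    · intro i i' hne
      rw [hK, hK]
      split_ifs with hi hi'
      · rw [inner_smul_left, inner_smul_right, inner_starProjection_orthogonal,
          b.inner_eq_zero hne, hbU i hi, hbU i' hi', inner_smul_left, inner_smul_right,
          c.inner_eq_zero hne]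
        simp
      all_goals simp

end PrincipalVectors

/-! ### Diagonal maps, the graph estimate and the choice of the admissible subspace -/

section CoordinateSpans

variable {𝕜 : Type*} [RCLike 𝕜] {n : ℕ}
  {x : OrthonormalBasis (Fin n) 𝕜 (EuclideanSpace 𝕜 (Fin n))}

theorem mem_orthogonal_span_image_iff {s : Set (Fin n)} {v : EuclideanSpace 𝕜 (Fin n)} :
    v ∈ (Submodule.span 𝕜 (x '' s))ᗮ ↔ ∀ i ∈ s, inner 𝕜 (x i) v = 0 := by
  rw [Submodule.mem_orthogonal]
  refine ⟨fun h i hi => h _ (Submodule.subset_span ⟨i, hi, rfl⟩), fun h u hu => ?_⟩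
  induction hu using Submodule.span_induction with
  | mem u hu => obtain ⟨i, hi, rfl⟩ := hu; exact h i hi
  | zero => simp
  | add u w _ _ hu hw => rw [inner_add_left, hu, hw, add_zero]
  | smul a u _ hu => rw [inner_smul_left, hu, mul_zero]

theorem mem_span_image_iff {s : Set (Fin n)} {v : EuclideanSpace 𝕜 (Fin n)} :
    v ∈ Submodule.span 𝕜 (x '' s) ↔ ∀ i ∉ s, inner 𝕜 (x i) v = 0 := by
  constructor
  · intro hv i hi
    induction hv using Submodule.span_induction with
    | mem u hu =>
      obtain ⟨l, hl, rfl⟩ := hu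
      exact x.inner_eq_zero (fun h => hi (h ▸ hl))
    | zero => simp
    | add u w _ _ hu hw => rw [inner_add_right, hu, hw, add_zero]
    | smul a u _ hu => rw [inner_smul_right, hu, mul_zero]
  · intro h
    rw [← x.sum_repr' v]
    refine Submodule.sum_mem _ fun i _ => ?_
    by_cases hi : i ∈ s
    · exact Submodule.smul_mem _ _ (Submodule.subset_span ⟨i, hi, rfl⟩)
    · rw [h i hi, zero_smul]
      exact zero_mem _

theorem finrank_span_image (s : Set (Fin n)) :
    finrank 𝕜 (Submodule.span 𝕜 (x '' s)) = s.ncard := by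
  classical
  have h := finrank_span_eq_card (R := 𝕜) (b := fun i : s => x i)
    (x.orthonormal.linearIndependent.comp _ Subtype.val_injective)
  rw [← Set.image_eq_range] at h
  rw [h, ← Nat.card_eq_fintype_card, Nat.card_coe_set_eq]

theorem ncard_fin_lt {l : ℕ} (hl : l ≤ n) : {i : Fin n | (i : ℕ) < l}.ncard = l := by
  rw [← Set.ncard_image_of_injective _ Fin.val_injective]
  have : (Fin.val '' {i : Fin n | (i : ℕ) < l} : Set ℕ) = (Finset.range l : Set ℕ) := by
    ext a
    simp only [Set.mem_image, Set.mem_ofPred_eq, Finset.coe_range, Set.mem_Iio]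
    exact ⟨fun ⟨i, hi, h⟩ => h ▸ hi, fun ha => ⟨⟨a, by omega⟩, ha, rfl⟩⟩
  rw [this, Set.ncard_coe_finset, Finset.card_range]

theorem ncard_fin_two_blocks {j k p₁ p₂ : ℕ} (hjk : j + p₁ ≤ k) (hk : k + p₂ ≤ n) :
    {i : Fin n | (j ≤ (i : ℕ) ∧ (i : ℕ) < j + p₁) ∨ (k ≤ (i : ℕ) ∧ (i : ℕ) < k + p₂)}.ncard =
      p₁ + p₂ := by
  rw [← Set.ncard_image_of_injective _ Fin.val_injective]
  have : (Fin.val '' {i : Fin n | (j ≤ (i : ℕ) ∧ (i : ℕ) < j + p₁) ∨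
      (k ≤ (i : ℕ) ∧ (i : ℕ) < k + p₂)} : Set ℕ) =
      ((Finset.Ico j (j + p₁) ∪ Finset.Ico k (k + p₂) : Finset ℕ) : Set ℕ) := by
    ext a
    simp only [Set.mem_image, Set.mem_ofPred_eq, Finset.coe_union, Finset.coe_Ico, Set.mem_union,
      Set.mem_Ico]
    exact ⟨fun ⟨i, hi, h⟩ => h ▸ hi, fun ha => ⟨⟨a, by omega⟩, ha, rfl⟩⟩
  rw [this, Set.ncard_coe_finset, Finset.card_union_of_disjoint, Nat.card_Ico, Nat.card_Ico]
  · omega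
  · rw [Finset.disjoint_left]
    intro a
    simp only [Finset.mem_Ico]
    omega

/-- The linear map that multiplies the `i`-th coordinate with respect to `x` by `d i`. -/
def diagMap (x : OrthonormalBasis (Fin n) 𝕜 (EuclideanSpace 𝕜 (Fin n))) (d : Fin n → 𝕜) :
    EuclideanSpace 𝕜 (Fin n) →ₗ[𝕜] EuclideanSpace 𝕜 (Fin n) :=
  x.toBasis.constr 𝕜 fun i => d i • x i

theorem diagMap_apply_basis (d : Fin n → 𝕜) (i : Fin n) : diagMap x d (x i) = d i • x i := by
  have := x.toBasis.constr_basis 𝕜 (fun i => d i • x i) i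
  rwa [x.coe_toBasis] at this

theorem inner_diagMap (d : Fin n → 𝕜) (i : Fin n) (v : EuclideanSpace 𝕜 (Fin n)) :
    inner 𝕜 (x i) (diagMap x d v) = d i * inner 𝕜 (x i) v := by
  conv_lhs => rw [← x.sum_repr' v]
  rw [map_sum, inner_sum, Finset.sum_eq_single i]
  · rw [map_smul, diagMap_apply_basis, inner_smul_right, inner_smul_right,
      inner_self_eq_norm_sq_to_K, x.norm_eq_one]
    simp [mul_comm]
  · intro l _ hl
    rw [map_smul, diagMap_apply_basis, inner_smul_right, inner_smul_right,
      x.inner_eq_zero hl.symm, mul_zero, mul_zero]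
  · simp

theorem norm_diagMap_le {d : Fin n → 𝕜} {a : ℝ} (ha : 0 ≤ a) (hd : ∀ i, ‖d i‖ ≤ a)
    (v : EuclideanSpace 𝕜 (Fin n)) : ‖diagMap x d v‖ ≤ a * ‖v‖ := by
  rw [← sq_le_sq₀ (norm_nonneg _) (by positivity), mul_pow, ← x.sum_sq_norm_inner_right,
    ← x.sum_sq_norm_inner_right v, Finset.mul_sum]
  refine Finset.sum_le_sum fun i _ => ?_
  rw [inner_diagMap, norm_mul, mul_pow]
  gcongr
  exact hd i

theorem ext_inner_basis {v w : EuclideanSpace 𝕜 (Fin n)}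
    (h : ∀ i, inner 𝕜 (x i) v = inner 𝕜 (x i) w) : v = w :=
  InnerProductSpace.ext_inner_left_basis x.toBasis fun i => by rw [x.coe_toBasis]; exact h i

theorem diagMap_inv_apply {s : Set (Fin n)} [DecidablePred (· ∈ s)] {μ : Fin n → 𝕜}
    (hμ : ∀ i ∈ s, μ i ≠ 0) {v : EuclideanSpace 𝕜 (Fin n)}
    (hv : v ∈ Submodule.span 𝕜 (x '' s)) :
    diagMap x (fun i => if i ∈ s then (μ i)⁻¹ else 0) (diagMap x μ v) = v := by
  refine ext_inner_basis (x := x) fun i => ?_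
  rw [inner_diagMap, inner_diagMap]
  split_ifs with hi
  · rw [inv_mul_cancel_left₀ (hμ i hi)]
  · rw [mem_span_image_iff.mp hv i hi, zero_mul]

/-- A vector of the kernel has zero coordinates on `s`, so the map is injective on `W`. -/
theorem finrank_map_diagMap {s : Set (Fin n)} {μ : Fin n → 𝕜} (hμ : ∀ i ∈ s, μ i ≠ 0)
    (W : Submodule 𝕜 (EuclideanSpace 𝕜 (Fin n)))
    (hW : W ⊓ (Submodule.span 𝕜 (x '' s))ᗮ = ⊥) :
    finrank 𝕜 (W.map (diagMap x μ)) = finrank 𝕜 W := by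
  rw [← LinearMap.range_domRestrict]
  refine LinearMap.finrank_range_of_inj ?_
  rw [← LinearMap.ker_eq_bot, LinearMap.ker_eq_bot']
  rintro ⟨w, hw⟩ h0
  have h0' : diagMap x μ w = 0 := h0
  have : w ∈ W ⊓ (Submodule.span 𝕜 (x '' s))ᗮ := by
    refine ⟨hw, mem_orthogonal_span_image_iff.mpr fun i hi => ?_⟩
    have := inner_diagMap (x := x) μ i w
    rw [h0', inner_zero_right] at this
    exact (mul_eq_zero.mp this.symm).resolve_left (hμ i hi)
  rw [hW, Submodule.mem_bot] at this
  exact Subtype.ext this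

/-- After applying `diagMap x μ`, distances from `T` are controlled by a map whose norm is bounded
by the tangents of the principal angles between `span {x i | i < l}` and `H`. -/
theorem exists_graph_bound {μ : Fin n → 𝕜} {l p : ℕ} (hμ : ∀ i : Fin n, (i : ℕ) < l → μ i ≠ 0)
    {a b : ℝ} (ha : 0 ≤ a) (hb : 0 ≤ b)
    (hμa : ∀ i : Fin n, (i : ℕ) < l → ‖(μ i)⁻¹‖ ≤ a)
    (hμb : ∀ i : Fin n, l + p ≤ (i : ℕ) → ‖μ i‖ ≤ b)
    (H T : Submodule 𝕜 (EuclideanSpace 𝕜 (Fin n)))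
    (hH : H ⊓ (Submodule.span 𝕜 (x '' {i | (i : ℕ) < l}))ᗮ = ⊥ ∨
      Hᗮ ⊓ Submodule.span 𝕜 (x '' {i | (i : ℕ) < l}) = ⊥)
    (hH₀ : ∀ v ∈ H, ∀ i : Fin n, l ≤ (i : ℕ) → (i : ℕ) < l + p → inner 𝕜 (x i) v = 0)
    (hHT : H.map (diagMap x μ) ≤ T)
    {N : Seminorm 𝕜 (Matrix (Fin n) (Fin n) 𝕜)} (hN : IsUnitarilyInvariantNorm N) :
    ∃ (V : Submodule 𝕜 (EuclideanSpace 𝕜 (Fin n)))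
      (G : EuclideanSpace 𝕜 (Fin n) →ₗ[𝕜] EuclideanSpace 𝕜 (Fin n)),
      V ≤ Submodule.span 𝕜 (x '' {i | (i : ℕ) < l}) ∧
      finrank 𝕜 V =
        min (finrank 𝕜 (Submodule.span 𝕜 (x '' {i | (i : ℕ) < l}))) (finrank 𝕜 H) ∧
      (∀ y ∈ V, ‖Tᗮ.starProjection y‖ ≤ ‖G y‖) ∧
      mapNorm N G ≤
        a * b * N (angleMatrix Real.tan (Submodule.span 𝕜 (x '' {i | (i : ℕ) < l})) H) := by
  classical
  obtain ⟨V, K, hVU, hVdim, hVH, hK, hKN⟩ := exists_tangent_map _ H hH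
  set F := diagMap x μ with hF
  set B := diagMap x (fun i => if i ∈ {i : Fin n | (i : ℕ) < l} then (μ i)⁻¹ else 0) with hB
  set C := diagMap x (fun i => if l + p ≤ (i : ℕ) then μ i else 0) with hC
  have hBF : ∀ v ∈ V, B (F v) = v := fun v hv =>
    diagMap_inv_apply (s := {i : Fin n | (i : ℕ) < l}) hμ (hVU hv)
  have hCK : ∀ v ∈ V, F (K v) = C (K v) := by
    intro v hv
    refine ext_inner_basis (x := x) fun i => ?_
    rw [inner_diagMap, inner_diagMap]
    split_ifs with hi
    · rfl
    · suffices inner 𝕜 (x i) (K v) = 0 by rw [this, mul_zero, mul_zero]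
      by_cases hil : (i : ℕ) < l
      · exact mem_orthogonal_span_image_iff.mp (hK v) i hil
      -- In the skipped block `v + K v ∈ H` has zero coordinates, and so does `v ∈ U`; hence `K v`
      -- does too, and `C` may ignore the block.
      · have h1 := hH₀ _ (hVH v hv) i (by omega) (by omega)
        rwa [inner_add_right, mem_span_image_iff.mp (hVU hv) i hil, zero_add] at h1
  refine ⟨V.map F, C ∘ₗ K ∘ₗ B, ?_, ?_, ?_, ?_⟩
  · rintro _ ⟨v, hv, rfl⟩
    refine mem_span_image_iff.mpr fun i hi => ?_
    rw [inner_diagMap, mem_span_image_iff.mp (hVU hv) i hi, mul_zero]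
  · rw [finrank_map_diagMap (s := {i : Fin n | (i : ℕ) < l}) hμ, hVdim]
    rw [eq_bot_iff, ← Submodule.inf_orthogonal_eq_bot
      (Submodule.span 𝕜 (x '' {i : Fin n | (i : ℕ) < l}))]
    exact inf_le_inf_right _ hVU
  · rintro _ ⟨v, hv, rfl⟩
    have h1 : F v + F (K v) ∈ T := by
      rw [← map_add]
      exact hHT ⟨_, hVH v hv, rfl⟩
    have h2 : Tᗮ.starProjection (F v) = -Tᗮ.starProjection (F (K v)) := by
      rw [eq_neg_iff_add_eq_zero, ← map_add, Submodule.starProjection_apply_eq_zero_iff]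
      exact Submodule.le_orthogonal_orthogonal T h1
    rw [h2, norm_neg]
    change _ ≤ ‖C (K (B (F v)))‖
    rw [hBF v hv, ← hCK v hv]
    exact Submodule.norm_starProjection_apply_le _ _
  · rw [← hKN N hN]
    refine hN.mapNorm_comp_comp_le C K B hb ha (norm_diagMap_le hb fun i => ?_)
      (norm_diagMap_le ha fun i => ?_)
    · split_ifs with hi
      · exact hμb i hi
      · simpa using hb
    · split_ifs with hi
      · exact hμa i hi
      · simpa using ha

theorem exists_le_finrank_eq (Z : Submodule 𝕜 (EuclideanSpace 𝕜 (Fin n))) {m : ℕ}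
    (hm : m ≤ finrank 𝕜 Z) : ∃ Y ≤ Z, finrank 𝕜 Y = m := by
  let b := finBasis 𝕜 Z
  refine ⟨Submodule.span 𝕜 (Set.range fun i : Fin m =>
    (b (i.castLE hm) : EuclideanSpace 𝕜 (Fin n))), ?_, ?_⟩
  · rw [Submodule.span_le]
    rintro _ ⟨i, rfl⟩
    exact Subtype.property _
  · rw [finrank_span_eq_card, Fintype.card_fin]
    exact (b.linearIndependent.map' Z.subtype (Submodule.ker_subtype Z)).comp _
      (Fin.castLE_injective hm)

theorem starProjection_sup_of_le_orthogonal (U S : Submodule 𝕜 (EuclideanSpace 𝕜 (Fin n)))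
    (h : S ≤ Uᗮ) (v : EuclideanSpace 𝕜 (Fin n)) :
    (U ⊔ S).starProjection v = U.starProjection v + S.starProjection v := by
  have h' : U ≤ Sᗮ := (Submodule.le_orthogonal_orthogonal U).trans (Submodule.orthogonal_le h)
  refine Submodule.eq_starProjection_of_mem_orthogonal'
    (z := v - (U.starProjection v + S.starProjection v)) ?_ ?_ (by abel)
  · exact add_mem (Submodule.mem_sup_left (U.starProjection_apply_mem v))
      (Submodule.mem_sup_right (S.starProjection_apply_mem v))
  · rw [← Submodule.inf_orthogonal]
    constructor
    · rw [← sub_sub]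
      exact sub_mem (Submodule.sub_starProjection_mem_orthogonal v)
        (h (S.starProjection_apply_mem v))
    · rw [add_comm, ← sub_sub]
      exact sub_mem (Submodule.sub_starProjection_mem_orthogonal v)
        (h' (U.starProjection_apply_mem v))

/-- By dimension count `V ∩ U^⊥` has dimension at least `dim V - dim U`, which leaves room for `S`.
-/
theorem exists_orthogonal_complement_finrank_eq
    (U V : Submodule 𝕜 (EuclideanSpace 𝕜 (Fin n))) {h : ℕ}
    (hUh : finrank 𝕜 U ≤ h) (hhV : h ≤ finrank 𝕜 V) :
    ∃ S ≤ V, S ≤ Uᗮ ∧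
      finrank 𝕜 (U ⊔ S : Submodule 𝕜 (EuclideanSpace 𝕜 (Fin n))) = h := by
  have hdim : h - finrank 𝕜 U ≤ finrank 𝕜 (V ⊓ Uᗮ : Submodule 𝕜 (EuclideanSpace 𝕜 (Fin n))) := by
    have h1 := Submodule.finrank_sup_add_finrank_inf_eq V Uᗮ
    have h2 := U.finrank_add_finrank_orthogonal
    have h3 := (V ⊔ Uᗮ).finrank_le
    omega
  obtain ⟨S, hS, hSdim⟩ := exists_le_finrank_eq _ hdim
  have hSU : S ≤ Uᗮ := hS.trans inf_le_right
  refine ⟨S, hS.trans inf_le_left, hSU, ?_⟩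
  have h1 := Submodule.finrank_sup_add_finrank_inf_eq U S
  have h2 : U ⊓ S = ⊥ := by
    rw [eq_bot_iff, ← Submodule.inf_orthogonal_eq_bot U]
    exact inf_le_inf_left _ hSU
  rw [h2, finrank_bot] at h1
  omega

/-- A bound valid on `Y` alone is enough: `G P_Y` dominates `P P_Y` everywhere, and `P_Y` is a
contraction. -/
theorem IsUnitarilyInvariantNorm.mapNorm_comp_starProjection_le
    {N : Seminorm 𝕜 (Matrix (Fin n) (Fin n) 𝕜)} (hN : IsUnitarilyInvariantNorm N)
    (P : EuclideanSpace 𝕜 (Fin n) →ₗ[𝕜] EuclideanSpace 𝕜 (Fin n))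
    (Y : Submodule 𝕜 (EuclideanSpace 𝕜 (Fin n)))
    (G : EuclideanSpace 𝕜 (Fin n) →ₗ[𝕜] EuclideanSpace 𝕜 (Fin n))
    (hG : ∀ y ∈ Y, ‖P y‖ ≤ ‖G y‖) :
    mapNorm N (P ∘ₗ Y.starProjection.toLinearMap) ≤ mapNorm N G := by
  have h1 : ∀ v, ‖(P ∘ₗ Y.starProjection.toLinearMap) v‖ ≤
      ‖(G ∘ₗ Y.starProjection.toLinearMap) v‖ := fun v => hG _ (Y.starProjection_apply_mem v)
  have h2 : ∀ v, ‖Y.starProjection.toLinearMap v‖ ≤ ‖v‖ := fun v =>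
    Y.norm_starProjection_apply_le v
  exact (hN.mapNorm_mono _ _ h1).trans (hN.mapNorm_comp_right_le _ G h2)

/-- A subspace between `U` and a larger space can be completed so that its distance from `T` is
controlled by separate bounds on `U` and on `V`. -/
theorem exists_between_norm_sin_le (U V T : Submodule 𝕜 (EuclideanSpace 𝕜 (Fin n))) {h : ℕ}
    (hUh : finrank 𝕜 U ≤ h) (hhV : h ≤ finrank 𝕜 V) (hhT : h ≤ finrank 𝕜 T)
    (G₁ G₂ : EuclideanSpace 𝕜 (Fin n) →ₗ[𝕜] EuclideanSpace 𝕜 (Fin n))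
    (hG₁ : ∀ y ∈ U, ‖Tᗮ.starProjection y‖ ≤ ‖G₁ y‖)
    (hG₂ : ∀ y ∈ V, ‖Tᗮ.starProjection y‖ ≤ ‖G₂ y‖)
    {N : Seminorm 𝕜 (Matrix (Fin n) (Fin n) 𝕜)} (hN : IsUnitarilyInvariantNorm N) :
    ∃ S : Submodule 𝕜 (EuclideanSpace 𝕜 (Fin n)),
      finrank 𝕜 S = h ∧ U ≤ S ∧ S ≤ U ⊔ V ∧
      N (angleMatrix Real.sin S T) ≤ mapNorm N G₁ + mapNorm N G₂ := by
  obtain ⟨S, hSV, hSU, hdimS⟩ := exists_orthogonal_complement_finrank_eq U V hUh hhV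
  refine ⟨U ⊔ S, hdimS, le_sup_left, sup_le_sup_left hSV _, ?_⟩
  rw [hN.norm_sin_angleMatrix _ _ (hdimS.trans_le hhT)]
  have hsplit : Tᗮ.starProjection.toLinearMap ∘ₗ (U ⊔ S).starProjection.toLinearMap =
      Tᗮ.starProjection.toLinearMap ∘ₗ U.starProjection.toLinearMap +
        Tᗮ.starProjection.toLinearMap ∘ₗ S.starProjection.toLinearMap := by
    ext1 v
    change Tᗮ.starProjection ((U ⊔ S).starProjection v) =
      Tᗮ.starProjection (U.starProjection v) + Tᗮ.starProjection (S.starProjection v)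
    rw [starProjection_sup_of_le_orthogonal U S hSU, map_add]
  rw [hsplit]
  refine (map_add_le_add (mapNorm N) _ _).trans (add_le_add ?_ ?_)
  · exact hN.mapNorm_comp_starProjection_le _ U G₁ hG₁
  · exact hN.mapNorm_comp_starProjection_le _ S G₂ fun y hy => hG₂ y (hSV hy)

/-- `W ∩ Q^⊥` is the orthogonal complement of the direct sum `W^⊥ + Q`. -/
theorem finrank_inf_orthogonal_add (W Q : Submodule 𝕜 (EuclideanSpace 𝕜 (Fin n)))
    (h : Wᗮ ⊓ Q = ⊥) :
    finrank 𝕜 (W ⊓ Qᗮ : Submodule 𝕜 (EuclideanSpace 𝕜 (Fin n))) + finrank 𝕜 Q =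
      finrank 𝕜 W := by
  have h1 := Submodule.finrank_sup_add_finrank_inf_eq Wᗮ Q
  have h2 := (Wᗮ ⊔ Q).finrank_add_finrank_orthogonal
  have h3 := W.finrank_add_finrank_orthogonal
  rw [← Submodule.inf_orthogonal, Submodule.orthogonal_orthogonal] at h2
  rw [h, finrank_bot] at h1
  omega

/-- The complement of `W ∩ Q^⊥` is `W^⊥ + Q`. If `w + q ∈ U` there, then `w ∈ W^⊥ ∩ I` vanishes,
leaving `q ∈ U ∩ Q`. -/
theorem orthogonal_inf_orthogonal_inf_eq_bot {W Q I U : Submodule 𝕜 (EuclideanSpace 𝕜 (Fin n))}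
    (hI : Wᗮ ⊓ I = ⊥) (hQ : Q ≤ I) (hU : U ≤ I) (hUQ : U ⊓ Q = ⊥) : (W ⊓ Qᗮ)ᗮ ⊓ U = ⊥ := by
  have h1 : W ⊓ Qᗮ = (Wᗮ ⊔ Q)ᗮ := by
    rw [← Submodule.inf_orthogonal, Submodule.orthogonal_orthogonal]
  rw [h1, Submodule.orthogonal_orthogonal, eq_bot_iff]
  rintro y ⟨hy, hyU⟩
  obtain ⟨w, hw, q, hq, rfl⟩ := Submodule.mem_sup.mp hy
  have h2 : w ∈ Wᗮ ⊓ I := ⟨hw, by simpa using sub_mem (hU hyU) (hQ hq)⟩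
  rw [hI, Submodule.mem_bot] at h2
  rw [h2, zero_add] at hyU ⊢
  rw [← hUQ]
  exact ⟨hyU, hq⟩

end CoordinateSpans

/-! ### Eigenvector bases, bound terms and the distance estimate -/

section Eigendecomposition

variable {𝕜 : Type*} [RCLike 𝕜] {n : ℕ}

theorem IsEigendecomposition.exists_orthonormalBasis {A X : Matrix (Fin n) (Fin n) 𝕜}
    {lam : Fin n → ℝ} (hA : IsEigendecomposition A X lam) :
    ∃ x : OrthonormalBasis (Fin n) 𝕜 (EuclideanSpace 𝕜 (Fin n)), ⇑x = column X := by
  have horth : Orthonormal 𝕜 ((Set.univ : Set (Fin n)).domRestrict (column X)) := by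
    have h : Orthonormal 𝕜 (column X) := by
      rw [orthonormal_iff_ite]
      intro i l
      have h1 := congrFun₂ (Matrix.mem_unitaryGroup_iff'.mp hA.unitary) i l
      rw [Matrix.mul_apply, Matrix.one_apply] at h1
      rw [← h1, PiLp.inner_apply]
      refine Finset.sum_congr rfl fun a _ => ?_
      simp [column, mul_comm, Matrix.star_apply]
    exact h.comp _ Subtype.val_injective
  obtain ⟨x, hx⟩ := horth.exists_orthonormalBasis_extension_of_card_eq (by simp)
  exact ⟨x, funext fun i => hx i trivial⟩

theorem IsEigendecomposition.toEuclideanLin_aeval {A X : Matrix (Fin n) (Fin n) 𝕜}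
    {lam : Fin n → ℝ} (hA : IsEigendecomposition A X lam)
    {x : OrthonormalBasis (Fin n) 𝕜 (EuclideanSpace 𝕜 (Fin n))} (hx : ⇑x = column X)
    (φ : Polynomial 𝕜) :
    Matrix.toEuclideanLin (Polynomial.aeval A φ) =
      diagMap x fun i => φ.eval (lam i : 𝕜) := by
  have hAX : A * X = X * Matrix.diagonal (fun i => (lam i : 𝕜)) := by
    have h1 : X.conjTranspose * X = 1 := Matrix.mem_unitaryGroup_iff'.mp hA.unitary
    rw [hA.eq, Matrix.mul_assoc, h1, Matrix.mul_one]
  refine x.toBasis.ext fun i => ?_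
  rw [x.coe_toBasis, diagMap_apply_basis]
  have heig : (Matrix.toLpLinAlgEquiv 2 A : End 𝕜 (EuclideanSpace 𝕜 (Fin n))).HasEigenvector
      (lam i : 𝕜) (x i) := by
    refine ⟨End.mem_eigenspace_iff.mpr ?_, x.orthonormal.ne_zero i⟩
    change Matrix.toEuclideanLin A (x i) = _
    ext a
    have h2 := congrFun₂ hAX a i
    rw [Matrix.mul_diagonal, Matrix.mul_apply] at h2
    rw [hx]
    simp only [Matrix.toLpLin_apply, Matrix.mulVec, dotProduct, column, PiLp.smul_apply,
      smul_eq_mul]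
    rw [h2, mul_comm]
  have h3 := End.aeval_apply_of_hasEigenvector (p := φ) heig
  rw [Polynomial.aeval_algHom_apply] at h3
  exact h3

theorem aeval_diagonal {m : Type*} [Fintype m] [DecidableEq m] (d : m → 𝕜) (φ : Polynomial 𝕜) :
    Polynomial.aeval (Matrix.diagonal d) φ = Matrix.diagonal fun i => φ.eval (d i) := by
  have h := Polynomial.aeval_algHom_apply (Matrix.diagonalAlgHom 𝕜 (n := m) (α := 𝕜)) d φ
  rw [Polynomial.aeval_pi_apply] at h
  simp only [Polynomial.coe_aeval_eq_eval] at h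
  exact h

theorem specNorm_nonneg {m : Type*} [Fintype m] [DecidableEq m] (M : Matrix m m 𝕜) :
    0 ≤ specNorm M := norm_nonneg _

theorem specNorm_diagonal {m : Type*} [Fintype m] [DecidableEq m] (d : m → 𝕜) :
    specNorm (Matrix.diagonal d) = ‖d‖ := by
  rw [specNorm, Matrix.l2_opNorm_toEuclideanCLM, Matrix.l2_opNorm_diagonal]

theorem isUnit_aeval_leadingDiag_iff {lam : Fin n → ℝ} {l : ℕ} {φ : Polynomial 𝕜} :
    IsUnit (Polynomial.aeval (leadingDiag 𝕜 lam l) φ) ↔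
      ∀ i : Fin n, (i : ℕ) < l → φ.eval (lam i : 𝕜) ≠ 0 := by
  rw [leadingDiag, aeval_diagonal, Matrix.isUnit_diagonal, Pi.isUnit_iff]
  simp only [isUnit_iff_ne_zero, Subtype.forall]

theorem norm_inv_eval_le_specNorm {lam : Fin n → ℝ} {l : ℕ} {φ : Polynomial 𝕜}
    (h : ∀ i : Fin n, (i : ℕ) < l → φ.eval (lam i : 𝕜) ≠ 0) (i : Fin n) (hi : (i : ℕ) < l) :
    ‖(φ.eval (lam i : 𝕜))⁻¹‖ ≤ specNorm (Polynomial.aeval (leadingDiag 𝕜 lam l) φ)⁻¹ := by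
  have hinv : (Polynomial.aeval (leadingDiag 𝕜 lam l) φ)⁻¹ =
      Matrix.diagonal fun i : {i : Fin n // (i : ℕ) < l} => (φ.eval (lam i : 𝕜))⁻¹ := by
    refine Matrix.inv_eq_right_inv ?_
    rw [leadingDiag, aeval_diagonal, Matrix.diagonal_mul_diagonal, ← Matrix.diagonal_one]
    congr 1
    ext i
    exact mul_inv_cancel₀ (h i.1 i.2)
  rw [hinv, specNorm_diagonal]
  exact norm_le_pi_norm (fun i : {i : Fin n // (i : ℕ) < l} => (φ.eval (lam i : 𝕜))⁻¹) ⟨i, hi⟩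

theorem norm_eval_le_specNorm {lam : Fin n → ℝ} {l : ℕ} {φ : Polynomial 𝕜} (i : Fin n)
    (hi : l ≤ (i : ℕ)) :
    ‖φ.eval (lam i : 𝕜)‖ ≤ specNorm (Polynomial.aeval (trailingDiag 𝕜 lam l) φ) := by
  rw [trailingDiag, aeval_diagonal, specNorm_diagonal]
  exact norm_le_pi_norm (fun i : {i : Fin n // l ≤ (i : ℕ)} => φ.eval (lam i : 𝕜)) ⟨i, hi⟩

theorem boundTerm_zero (N : Seminorm 𝕜 (Matrix (Fin n) (Fin n) 𝕜)) (X : Matrix (Fin n) (Fin n) 𝕜)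
    (lam : Fin n → ℝ) (φ : Polynomial 𝕜) (p : ℕ)
    (H : Submodule 𝕜 (EuclideanSpace 𝕜 (Fin n))) : boundTerm N X lam φ 0 p H = 0 := by
  have h : leadingSpan X 0 = ⊥ := by simp [leadingSpan]
  have h' : finrank 𝕜 (leadingSpan X 0) = 0 := by rw [h, finrank_bot]
  simp [boundTerm, angleMatrix, h']

theorem boundTerm_eq_zero_of_eval_eq_zero (N : Seminorm 𝕜 (Matrix (Fin n) (Fin n) 𝕜))
    (X : Matrix (Fin n) (Fin n) 𝕜) {lam : Fin n → ℝ} {φ : Polynomial 𝕜} {l : ℕ} (p : ℕ)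
    (H : Submodule 𝕜 (EuclideanSpace 𝕜 (Fin n)))
    (h : ∀ i : Fin n, l ≤ (i : ℕ) → φ.eval (lam i : 𝕜) = 0) : boundTerm N X lam φ l p H = 0 := by
  have h0 : specNorm (Polynomial.aeval (trailingDiag 𝕜 lam (l + p)) φ) = 0 := by
    rw [trailingDiag, aeval_diagonal, specNorm_diagonal, norm_eq_zero]
    ext i
    exact h i.1 ((Nat.le_add_right l p).trans i.2)
  rw [boundTerm, h0, mul_zero, zero_mul]

theorem IsEigendecomposition.rank_eq_ncard {A X : Matrix (Fin n) (Fin n) 𝕜}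
    {lam : Fin n → ℝ} (hA : IsEigendecomposition A X lam) :
    A.rank = {i | lam i ≠ 0}.ncard := by
  classical
  have hX : IsUnit X.det := (Matrix.isUnit_iff_isUnit_det X).mp
    (Unitary.isUnit_coe (U := ⟨X, hA.unitary⟩))
  have hX' : IsUnit X.conjTranspose.det := by
    rw [Matrix.det_conjTranspose]
    exact hX.star
  rw [hA.eq, Matrix.rank_mul_eq_left_of_isUnit_det _ _ hX',
    Matrix.rank_mul_eq_right_of_isUnit_det _ _ hX, Matrix.rank_diagonal,
    ← Nat.card_eq_fintype_card, ← Nat.card_coe_set_eq]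
  refine Nat.card_congr (Equiv.subtypeEquivRight fun i => ?_)
  simp

/-- The rank counts the nonzero eigenvalues, so the leading ones already exhaust them. -/
theorem IsEigendecomposition.eigenvalue_eq_zero {A X : Matrix (Fin n) (Fin n) 𝕜}
    {lam : Fin n → ℝ} (hA : IsEigendecomposition A X lam)
    (h : ∀ i : Fin n, (i : ℕ) < A.rank → lam i ≠ 0) (i : Fin n) (hi : A.rank ≤ (i : ℕ)) :
    lam i = 0 := by
  have hle : A.rank ≤ n := by simpa using A.rank_le_width
  have heq : {i : Fin n | (i : ℕ) < A.rank} = {i | lam i ≠ 0} :=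
    Set.eq_of_subset_of_ncard_le h (by rw [ncard_fin_lt hle, hA.rank_eq_ncard])
  by_contra h0
  have : i ∈ {i : Fin n | (i : ℕ) < A.rank} := heq ▸ h0
  exact absurd this (not_lt.mpr hi)

theorem admDist_le {N : Seminorm 𝕜 (Matrix (Fin n) (Fin n) 𝕜)} {X : Matrix (Fin n) (Fin n) 𝕜}
    {j h k : ℕ} {S T : Submodule 𝕜 (EuclideanSpace 𝕜 (Fin n))} (hS : S ∈ admissible X j h k) :
    admDist N X j h k T ≤ N (angleMatrix Real.sin S T) :=
  csInf_le ⟨0, by rintro _ ⟨S, -, rfl⟩; exact apply_nonneg N _⟩ ⟨S, hS, rfl⟩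

theorem leadingSpan_mono (X : Matrix (Fin n) (Fin n) 𝕜) {j k : ℕ} (hjk : j ≤ k) :
    leadingSpan X j ≤ leadingSpan X k :=
  Submodule.span_mono (Set.image_mono fun _ hi => lt_of_lt_of_le hi hjk)

/-- The bound for a subspace `H` of `W` whose coordinates in the two blocks
`j ≤ i < j + p₁` and `k ≤ i < k + p₂` vanish. -/
theorem IsEigendecomposition.admDist_le_add {A X : Matrix (Fin n) (Fin n) 𝕜} {lam : Fin n → ℝ}
    (hA : IsEigendecomposition A X lam) {j h k p₁ p₂ : ℕ} (hjh : j ≤ h) (hhk : h ≤ k) (hkn : k ≤ n)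
    {W H : Submodule 𝕜 (EuclideanSpace 𝕜 (Fin n))} (hHW : H ≤ W) (hhH : h ≤ finrank 𝕜 H)
    (hHk : finrank 𝕜 H ≤ k)
    (hH : ∀ v ∈ H, ∀ i : Fin n, (j ≤ (i : ℕ) ∧ (i : ℕ) < j + p₁) ∨
      (k ≤ (i : ℕ) ∧ (i : ℕ) < k + p₂) → inner 𝕜 (column X i) v = 0)
    (hHj : Hᗮ ⊓ leadingSpan X j = ⊥) (hHk' : H ⊓ (leadingSpan X k)ᗮ = ⊥)
    (hW : W ⊓ (leadingSpan X k)ᗮ = ⊥) {φ : Polynomial 𝕜}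
    (hφ : ∀ i : Fin n, (i : ℕ) < k → φ.eval (lam i : 𝕜) ≠ 0)
    {N : Seminorm 𝕜 (Matrix (Fin n) (Fin n) 𝕜)} (hN : IsUnitarilyInvariantNorm N) :
    admDist N X j h k (image (Polynomial.aeval A φ) W) ≤
      boundTerm N X lam φ j p₁ H + boundTerm N X lam φ k p₂ H := by
  obtain ⟨x, hx⟩ := hA.exists_orthonormalBasis
  have hmono := leadingSpan_mono X (hjh.trans hhk)
  have hφj : ∀ i : Fin n, (i : ℕ) < j → φ.eval (lam i : 𝕜) ≠ 0 :=
    fun i hi => hφ i (hi.trans_le (hjh.trans hhk))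
  set T := image (Polynomial.aeval A φ) W with hT
  have hTmap : T = W.map (diagMap x fun i => φ.eval (lam i : 𝕜)) := by
    rw [hT, image, hA.toEuclideanLin_aeval hx]
  have hHT : H.map (diagMap x fun i => φ.eval (lam i : 𝕜)) ≤ T := by
    rw [hTmap]
    exact Submodule.map_mono hHW
  have hspan : ∀ l, leadingSpan X l = Submodule.span 𝕜 (x '' {i | (i : ℕ) < l}) := fun l => by
    rw [hx]; rfl
  have hdim : ∀ l ≤ n, finrank 𝕜 (Submodule.span 𝕜 (x '' {i | (i : ℕ) < l})) = l := fun l hl => by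
    rw [finrank_span_image, ncard_fin_lt hl]
  rw [← hx] at hH
  rw [hspan] at hHj hHk' hW
  obtain ⟨V₁, G₁, hV₁, hV₁dim, hG₁, hNG₁⟩ := exists_graph_bound (x := x) (p := p₁)
    (l := j) hφj (specNorm_nonneg _) (specNorm_nonneg _) (norm_inv_eval_le_specNorm hφj)
    norm_eval_le_specNorm H T (Or.inr hHj)
    (fun v hv i h1 h2 => hH v hv i (Or.inl ⟨h1, h2⟩)) hHT hN
  obtain ⟨V₂, G₂, hV₂, hV₂dim, hG₂, hNG₂⟩ := exists_graph_bound (x := x) (p := p₂)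
    (l := k) hφ (specNorm_nonneg _) (specNorm_nonneg _) (norm_inv_eval_le_specNorm hφ)
    norm_eval_le_specNorm H T (Or.inl hHk')
    (fun v hv i h1 h2 => hH v hv i (Or.inr ⟨h1, h2⟩)) hHT hN
  rw [hdim j (by omega)] at hV₁dim
  rw [hdim k hkn] at hV₂dim
  -- Here the minimum of the dimensions is `j`, because `j ≤ h ≤ dim H`.
  have hV₁eq : V₁ = leadingSpan X j := by
    rw [hspan]
    exact Submodule.eq_of_le_of_finrank_eq hV₁ (by rw [hV₁dim, hdim j (by omega)]; omega)
  -- Needed for `h ≤ dim T`, without which the sine matrix would be truncated below size `h`.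
  have hTdim : finrank 𝕜 T = finrank 𝕜 W := by
    rw [hTmap]
    exact finrank_map_diagMap (s := {i : Fin n | (i : ℕ) < k}) hφ W hW
  obtain ⟨S, hS, hUS, hSUV, hSN⟩ := exists_between_norm_sin_le V₁ V₂ T (h := h) (by omega)
    (by omega) (by have := Submodule.finrank_mono hHW; omega) G₁ G₂ hG₁ hG₂ hN
  have hSadm : S ∈ admissible X j h k := by
    refine ⟨hS, hV₁eq ▸ hUS, hSUV.trans (sup_le ?_ ?_)⟩
    · rw [hV₁eq]
      exact hmono
    · rw [hspan]
      exact hV₂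
  rw [← hspan] at hNG₁ hNG₂
  exact (admDist_le hSadm).trans (hSN.trans (add_le_add hNG₁ hNG₂))

/-- Existence of a subspace of `W` of the expected dimension whose coordinates in the blocks
`j ≤ i < j + p₁` and `k ≤ i < k + p₂` vanish. -/
theorem IsEigendecomposition.exists_subspace {A X : Matrix (Fin n) (Fin n) 𝕜} {lam : Fin n → ℝ}
    (hA : IsEigendecomposition A X lam) {j k p₁ p₂ : ℕ} (hjk : j + p₁ ≤ k) (hk : k + p₂ ≤ n)
    (W : Submodule 𝕜 (EuclideanSpace 𝕜 (Fin n)))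
    (hW : Wᗮ ⊓ Submodule.span 𝕜 (column X ''
      {i | (i : ℕ) < j + p₁ ∨ (k ≤ (i : ℕ) ∧ (i : ℕ) < k + p₂)}) = ⊥) :
    ∃ H ≤ W, finrank 𝕜 H + (p₁ + p₂) = finrank 𝕜 W ∧ Hᗮ ⊓ leadingSpan X j = ⊥ ∧
      ∀ v ∈ H, ∀ i : Fin n, (j ≤ (i : ℕ) ∧ (i : ℕ) < j + p₁) ∨
        (k ≤ (i : ℕ) ∧ (i : ℕ) < k + p₂) → inner 𝕜 (column X i) v = 0 := by
  obtain ⟨x, hx⟩ := hA.exists_orthonormalBasis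
  rw [leadingSpan, ← hx]
  rw [← hx] at hW
  set J : Set (Fin n) := {i | (j ≤ (i : ℕ) ∧ (i : ℕ) < j + p₁) ∨
        (k ≤ (i : ℕ) ∧ (i : ℕ) < k + p₂)} with hJ
  have hJI : Submodule.span 𝕜 (x '' J) ≤ Submodule.span 𝕜 (x ''
      {i | (i : ℕ) < j + p₁ ∨ (k ≤ (i : ℕ) ∧ (i : ℕ) < k + p₂)}) :=
    Submodule.span_mono (Set.image_mono fun i hi => hi.imp_left And.right)
  refine ⟨W ⊓ (Submodule.span 𝕜 (x '' J))ᗮ, inf_le_left, ?_, ?_, ?_⟩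
  · have h1 := finrank_inf_orthogonal_add W (Submodule.span 𝕜 (x '' J))
      (eq_bot_iff.mpr ((inf_le_inf_left _ hJI).trans hW.le))
    rwa [finrank_span_image J, ncard_fin_two_blocks hjk hk] at h1
  · refine orthogonal_inf_orthogonal_inf_eq_bot hW hJI
      (Submodule.span_mono (Set.image_mono fun i hi => Or.inl ?_)) ?_
    · exact lt_of_lt_of_le hi (Nat.le_add_right j p₁)
    · rw [eq_bot_iff]
      rintro v ⟨h1, h2⟩
      rw [Submodule.mem_bot]
      refine ext_inner_basis (x := x) fun i => ?_
      rw [inner_zero_right]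
      by_cases hi : (i : ℕ) < j
      · refine mem_span_image_iff.mp h2 i ?_
        rintro (h | h) <;> omega
      · exact mem_span_image_iff.mp h1 i hi
  · exact fun v hv => mem_orthogonal_span_image_iff.mp hv.2

end Eigendecomposition

end LambdaAdm

end

/-! ### The theorem and its degenerate cases -/

theorem mainTheorem2 {𝕜 : Type*} [RCLike 𝕜] {n : ℕ}
    (A X : Matrix (Fin n) (Fin n) 𝕜) (lam : Fin n → ℝ)
    (hA : LambdaAdm.IsEigendecomposition A X lam)
    (j h k : ℕ) (hjh : j < h) (hhk : h < k) (hk : k ≤ A.rank)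
    (hgapj : LambdaAdm.HasGap lam j) (hgapk : LambdaAdm.HasGap lam k)
    (W : Submodule 𝕜 (EuclideanSpace 𝕜 (Fin n))) (r : ℕ) (hW : Module.finrank 𝕜 W = r)
    (hhr : h ≤ r) (hrk : r < k)
    (p₁ p₂ : ℕ) (hp : p₁ + p₂ ≤ r - h) (hp₂ : k + p₂ ≤ n)
    (hW₁ : Wᗮ ⊓ Submodule.span 𝕜 (LambdaAdm.column X ''
      {i | (i : ℕ) < j + p₁ ∨ (k ≤ (i : ℕ) ∧ (i : ℕ) < k + p₂)}) = ⊥)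
    (hW₂ : W ⊓ (LambdaAdm.leadingSpan X k)ᗮ = ⊥) :
    ∃ H : Submodule 𝕜 (EuclideanSpace 𝕜 (Fin n)),
      H ≤ W ∧
      Module.finrank 𝕜 H = r - (p₁ + p₂) ∧
      h ≤ Module.finrank 𝕜 H ∧
      Hᗮ ⊓ LambdaAdm.leadingSpan X j = ⊥ ∧
      H ⊓ (LambdaAdm.leadingSpan X k)ᗮ = ⊥ ∧
      ∀ φ : Polynomial 𝕜, IsUnit (Polynomial.aeval (LambdaAdm.leadingDiag 𝕜 lam k) φ) →
      ∀ N : Seminorm 𝕜 (Matrix (Fin n) (Fin n) 𝕜), LambdaAdm.IsUnitarilyInvariantNorm N →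
        LambdaAdm.admDist N X j h k (LambdaAdm.image (Polynomial.aeval A φ) W) ≤
            LambdaAdm.boundTerm N X lam φ j p₁ H + LambdaAdm.boundTerm N X lam φ k p₂ H ∧
        (j = 0 →
          LambdaAdm.admDist N X j h k (LambdaAdm.image (Polynomial.aeval A φ) W) ≤
            LambdaAdm.boundTerm N X lam φ k p₂ H) ∧
        (k = A.rank → φ.eval 0 = 0 →
          LambdaAdm.admDist N X j h k (LambdaAdm.image (Polynomial.aeval A φ) W) ≤
            LambdaAdm.boundTerm N X lam φ j p₁ H) ∧
        (j = 0 → k = A.rank → φ.eval 0 = 0 →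
          LambdaAdm.admDist N X j h k (LambdaAdm.image (Polynomial.aeval A φ) W) ≤ 0) := by

  have hkn : k ≤ n := by omega
  -- The two blocks are disjoint: `j + p₁ < h + (r - h) = r < k`.
  obtain ⟨H, hHW, hHdim, hHj, hH⟩ := hA.exists_subspace (j := j) (k := k) (by omega) hp₂ W hW₁
  have hHk : H ⊓ (LambdaAdm.leadingSpan X k)ᗮ = ⊥ :=
    eq_bot_iff.mpr ((inf_le_inf_right _ hHW).trans hW₂.le)
  refine ⟨H, hHW, by omega, by omega, hHj, hHk, fun φ hφ N hN => ?_⟩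
  have hφ' := LambdaAdm.isUnit_aeval_leadingDiag_iff.mp hφ
  have hmain := hA.admDist_le_add hjh.le hhk.le hkn hHW (by omega) (by omega) hH hHj hHk hW₂ hφ' hN
  have hj0 : j = 0 → LambdaAdm.boundTerm N X lam φ j p₁ H = 0 := by
    rintro rfl
    exact LambdaAdm.boundTerm_zero N X lam φ p₁ H
  have hk0 : k = A.rank → φ.eval 0 = 0 → LambdaAdm.boundTerm N X lam φ k p₂ H = 0 := by
    intro hkr h0
    refine LambdaAdm.boundTerm_eq_zero_of_eval_eq_zero N X p₂ H fun i hi => ?_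
    -- As `φ(0) = 0`, invertibility of `φ(Λ_k)` excludes zero among the first `k = rk(A)`
    -- eigenvalues; all later ones then vanish, and `φ` with them.
    have hlam : ∀ i : Fin n, (i : ℕ) < A.rank → lam i ≠ 0 := fun i hi h => by
      refine hφ' i (hkr ▸ hi) ?_
      rw [h, RCLike.ofReal_zero, h0]
    rw [hA.eigenvalue_eq_zero hlam i (hkr ▸ hi), RCLike.ofReal_zero, h0]
  refine ⟨hmain, fun h1 => ?_, fun h1 h2 => ?_, fun h1 h2 h3 => ?_⟩
  · rwa [hj0 h1, zero_add] at hmain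
  · rwa [hk0 h1 h2, add_zero] at hmain
  · rwa [hj0 h1, hk0 h2 h3, add_zero] at hmain
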